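/- Fix $N\ge 2$. Let $Y=\{x\in\mathbb R^N:\sum_i x_i=0\}$ with the Euclidean inner product, and let $p_j=\bigl(e_j-\tfrac1N(1,\dots,1)\bigr)/\sqrt2\in Y$ for $1\le j\le N$; these are the vertices of a regular simplex with unit side lengths. Let $T_j:Y\to Y$ be the linear map that multiplies vectors in the direction of $p_j$ by $N/(N+2)$ and vectors orthogonal to $p_j$ by $1/(N+2)$, and put $S_j(x)=T_j(x-p_j)+p_j$. There is a unique non-empty compact set $X\subset Y$ with $X=\bigcup_{j=1}^N S_j(X)$ (the harmonic $N$-Sierpinski gasket), and a unique non-empty compact set $\Gamma\subset Y$ with $\Gamma=S_1(\Gamma)\cup S_2(\Gamma)$. For a finite word $v=v_1\cdots v_m$ write $S_v=S_{v_1}\circ\dots\circ S_{v_m}$, $T_v=T_{v_1}\cdots T_{v_m}$ and $Z_v=T_vT_v^{t}/\|T_v\|_{\mathrm{HS}}^2$, with the Hilbert–Schmidt norm; for an infinite word $w=w_1w_2\cdots$ write $[w]_m=w_1\cdots w_m$ and let $Z(w)=\lim_{m\to\infty}Z_{[w]_m}$ whenever the limit exists. A regular parametrization of $\Gamma$ of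 class $C^k$ is a $C^k$ map $g:[0,1]\to Y$ with image $\Gamma$ and with $g'(t)\neq0$ for all $t\in[0,1]$. **Theorem.** 1. $\Gamma$ is a $C^1$ plane curve joining $p_1$ and $p_2$: it is contained in the linear span of $p_1$ and $p_2$, and it has an injective regular parametrization $g$ of class $C^1$ with $g(0)=p_1$ and $g(1)=p_2$. 2. If $N\ge3$, then $\Gamma$ is not $C^2$, that is, it has no regular parametrization of class $C^2$; but it has an injective regular $C^1$ parametrization $g$ with $g(0)=p_1$, $g(1)=p_2$, whose derivative $g'$ is Hölder continuous on $[0,1]$ with the (positive) exponent $$\frac{\log N+2\log 2-2\log\bigl(1+\sqrt{4N+1}\bigr)}{\log\bigl(1+\sqrt{4N+1}\bigr)-\log2-\log(N+2)}.$$ 3. For each $x\in\Gamma$ there is an infinite word $w$ with letters in $\{1,2\}$ such that $\bigcap_m S_{[w]_m}(X)=\{x\}$. For every such $x$ and $w$ the limit $Z(w)$ exists and is the orthogonal projection of $Y$ onto the tangent direction of $\Gamma$ at $x$, i.e. onto $\mathbb R\,g'(t)$, for every regular $C^1$ parametrization $g$ of $\Gamma$ and every $t$ with $g(t)=x$. 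-/

import Mathlib

open Set Filter Topology
open scoped NNReal

noncomputable section

namespace HarmonicGasket

/-- The hyperplane `Y = {x ∈ ℝ^N : x_1 + ⋯ + x_N = 0}` with the Euclidean inner product. -/
abbrev Y (N : ℕ) : Submodule ℝ (EuclideanSpace ℝ (Fin N)) where
  carrier := {x | ∑ i, x i = 0}
  add_mem' := by
    intro a b ha hb
    simp only [Set.mem_ofPred_eq, PiLp.add_apply, Finset.sum_add_distrib] at *
    rw [ha, hb, add_zero]
  zero_mem' := by simp
  smul_mem' := by
    intro c x hx
    simp only [Set.mem_ofPred_eq, PiLp.smul_apply, smul_eq_mul, ← Finset.mul_sum] at *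
    rw [hx, mul_zero]

/-- The vertices `p_j = (e_j - (1, …, 1) / N) / √2` of a regular simplex with unit sides in `Y`. -/
def p {N : ℕ} (j : Fin N) : Y N :=
  ⟨WithLp.toLp 2 fun i => ((if i = j then 1 else 0) - 1 / (N : ℝ)) / √2, by
    have hN : (N : ℝ) ≠ 0 := Nat.cast_ne_zero.mpr (Fin.pos j).ne'
    change ∑ i, ((if i = j then (1 : ℝ) else 0) - 1 / (N : ℝ)) / √2 = 0
    rw [← Finset.sum_div, Finset.sum_sub_distrib]
    simp [hN]⟩

/-- The linear map `T_j` on `Y`: it multiplies the direction of `p_j` by `N / (N + 2)` and all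
orthogonal directions by `1 / (N + 2)`. -/
def T {N : ℕ} (j : Fin N) : Y N →L[ℝ] Y N :=
  ((N : ℝ) / (N + 2)) • (Submodule.span ℝ {p j}).starProjection
    + (1 / ((N : ℝ) + 2)) • (Submodule.span ℝ {p j})ᗮ.starProjection

/-- The affine map `S_j x = T_j (x - p_j) + p_j`. -/
def S {N : ℕ} (j : Fin N) (x : Y N) : Y N := T j (x - p j) + p j

/-- `K` is a non-empty compact set with `K = ⋃ i, f i '' K`. -/
structure IsAttractor {ι E : Type*} [TopologicalSpace E] (f : ι → E → E) (K : Set E) : Prop where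
  nonempty : K.Nonempty
  isCompact : IsCompact K
  eq_iUnion : K = ⋃ i, f i '' K

/-- The word formed by the first `m` letters of the infinite word `w`. -/
def trunc {N : ℕ} (w : ℕ → Fin N) (m : ℕ) : List (Fin N) := (List.range m).map w

/-- `T_w = T_{w_1} ⋯ T_{w_m}` for a finite word `w = w_1 ⋯ w_m`. -/
def Tword {N : ℕ} : List (Fin N) → (Y N →L[ℝ] Y N)
  | [] => ContinuousLinearMap.id ℝ (Y N)
  | j :: v => (T j).comp (Tword v)

/-- `S_w = S_{w_1} ∘ ⋯ ∘ S_{w_m}` for a finite word `w = w_1 ⋯ w_m`. -/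
def Sword {N : ℕ} : List (Fin N) → Y N → Y N
  | [] => id
  | j :: v => S j ∘ Sword v

/-- The square of the Hilbert-Schmidt norm: the sum of the squares of the matrix coefficients with
respect to an orthonormal basis (it does not depend on the basis). -/
def hsNormSq {N : ℕ} (A : Y N →L[ℝ] Y N) : ℝ :=
  ∑ i, ∑ k, (inner ℝ (stdOrthonormalBasis ℝ (Y N) i) (A (stdOrthonormalBasis ℝ (Y N) k))) ^ 2

/-- Kusuoka's operator `T_w T_wᵗ / ‖T_w‖²` (Hilbert-Schmidt norm) for a finite word `w`. -/
def Z {N : ℕ} (w : List (Fin N)) : Y N →L[ℝ] Y N :=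
  (hsNormSq (Tword w))⁻¹ • (Tword w).comp (ContinuousLinearMap.adjoint (Tword w))

/-- `g` is a regular (nowhere vanishing derivative) parametrization of class `C^k` of the set `C`
by the unit interval. -/
structure IsRegularParam {E : Type*} [NormedAddCommGroup E] [NormedSpace ℝ E]
    (k : ℕ) (g : ℝ → E) (C : Set E) : Prop where
  contDiffOn : ContDiffOn ℝ k g (Icc 0 1)
  derivWithin_ne_zero : ∀ t ∈ Icc (0 : ℝ) 1, derivWithin g (Icc 0 1) t ≠ 0
  image_eq : g '' Icc 0 1 = C

/-- `g` is a regular parametrization of class `C^k` of `C` as a simple arc from `a` to `b`. -/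
structure IsRegularArcParam {E : Type*} [NormedAddCommGroup E] [NormedSpace ℝ E]
    (k : ℕ) (g : ℝ → E) (C : Set E) (a b : E) : Prop extends IsRegularParam k g C where
  injOn : InjOn g (Icc 0 1)
  map_zero : g 0 = a
  map_one : g 1 = b

/-- The Hölder exponent. -/
def holderExp (N : ℕ) : ℝ :=
  (Real.log N + 2 * Real.log 2 - 2 * Real.log (1 + √(4 * (N : ℝ) + 1))) /
    (Real.log (1 + √(4 * (N : ℝ) + 1)) - Real.log 2 - Real.log ((N : ℝ) + 2))

end HarmonicGasket

end

/-!
In the plane of `p_1` and `p_2`, with coordinates `(a, b) ↔ -a p_1 + b p_2`, the maps `(N + 2) T_1`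
and `(N + 2) T_2` have the matrices `(N, 1; 0, 1)` and `(1, 0; 1, N)`. They preserve the cone of
non-negative vectors, and they act on its directions `(1 - τ, τ)`, `τ ∈ [0, 1]`, by two homographies
that map `[0, 1]` onto `[0, 1/2]` and onto `[1/2, 1]` (`slopeMap`). So `Γ` is a convex curve of the
kind studied by de Rham, and it is natural to parametrize it by the slope `τ` of its tangents: the
parametrization is the fixed point of a contraction of a space of functions whose chords have slopes
between those of their end points (`exists_isSlopeParam`).

For a word of length `m`, let `B` and `A` be the sums of the coordinates of the images of `(1, 0)`
and `(0, 1)` under `(N + 2) ^ m T_v`. Appending a letter replaces `(B, A)` by `(N B, A + B)` or by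
`(A + B, N A)`. The ratios of `A` and `B` are at most `N - 1`, and `A + B ≥ λ ^ m` for
`λ = (1 + √(4 N + 1)) / 2` (`weight_le`, `pow_le_weight_add`): indeed the smaller one of `λ A + B`
and `A + λ B` grows at least by the factor `λ`, and along the word `1212⋯` not by more.
The cell of slopes of the word has length `N ^ m / (A B) ≲ (N / λ²) ^ m` (`wordSlope_sub_le`), while
the corresponding arc of `Γ` has length of order at least `(λ / (N + 2)) ^ m`. Two slopes are compared in the last cell that
contains both (`exists_separating_word`), inside of which slopes are controlled linearly by
abscissas (`sub_le_of_separated`). This shows that the slope is a Hölder continuous function of the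
abscissa, with the stated exponent (`sub_le_rpow`), so `Γ` is the graph of a `C^1` function
(`exists_slope`).

At the end point `p_1` slopes contract faster than abscissas as soon as `N > 2`, by the factors
`1 / N` and `N / (N + 2)`, so by self-similarity there is no interval on which slopes grow at least
linearly in the abscissa (`not_expanding`). For a `C^2` parametrization the slope would be a `C^1`
function of the parameter, with a non-zero derivative somewhere because it takes the values `0` and
`1`, and such an interval would exist (`not_isRegularParam_two`).

Finally `T_v` maps the cone into the cell of slopes of `v` and is the homothety of ratio
`(N + 2) ^ (-m)` on the orthogonal complement of the plane, which is negligible because `λ > 1`.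
So the image of `T_v` concentrates on the tangent direction, and `T_v T_vᵗ / ‖T_v‖²` converges to
the projection onto it (`tendsto_Z`).
-/

namespace HarmonicGasket

/-! ### The two maps in the plane and their action on slopes -/

/-- The maps `T_1` (letter `false`) and `T_2` (letter `true`) on the plane spanned by `p_1` and
`p_2`. The pair `(a, b)` stands for the vector `-a p_1 + b p_2`: with this sign the cone of
non-negative pairs is mapped into itself, and it contains the chords of `Γ`. -/
noncomputable def planeT (n : ℝ) (b : Bool) : (ℝ × ℝ) →ₗ[ℝ] ℝ × ℝ where
  toFun z := bif b then (z.1 / (n + 2), (z.1 + n * z.2) / (n + 2))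
    else ((n * z.1 + z.2) / (n + 2), z.2 / (n + 2))
  map_add' x y := by cases b <;> ext <;> simp <;> ring
  map_smul' c x := by cases b <;> ext <;> simp <;> ring

/-- The coordinates of `p_1` and `p_2`. -/
noncomputable def planeV (b : Bool) : ℝ × ℝ := bif b then (0, 1) else (-1, 0)

/-- The maps `S_1` and `S_2` in the plane. -/
noncomputable def planeS (n : ℝ) (b : Bool) (z : ℝ × ℝ) : ℝ × ℝ :=
  planeT n b (z - planeV b) + planeV b

/-- The action of `planeT n b` on directions, where `τ ∈ [0, 1]` stands for the direction of
`(1 - τ, τ)`. The two maps send `[0, 1]` onto `[0, 1 / 2]` and `[1 / 2, 1]`. -/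
noncomputable def slopeMap (n : ℝ) (b : Bool) (τ : ℝ) : ℝ :=
  bif b then ((1 - τ) + n * τ) / (2 * (1 - τ) + n * τ) else τ / (n * (1 - τ) + 2 * τ)

/-- The factor by which `planeT n b` stretches `(1 - τ, τ)`, measured by the sum of the
coordinates. -/
noncomputable def stretch (n : ℝ) (b : Bool) (τ : ℝ) : ℝ :=
  bif b then (2 * (1 - τ) + n * τ) / (n + 2) else (n * (1 - τ) + 2 * τ) / (n + 2)

@[simp] lemma planeT_false (n : ℝ) (z : ℝ × ℝ) :
    planeT n false z = ((n * z.1 + z.2) / (n + 2), z.2 / (n + 2)) := rfl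

@[simp] lemma planeT_true (n : ℝ) (z : ℝ × ℝ) :
    planeT n true z = (z.1 / (n + 2), (z.1 + n * z.2) / (n + 2)) := rfl

@[simp] lemma planeV_false : planeV false = (-1, 0) := rfl
@[simp] lemma planeV_true : planeV true = (0, 1) := rfl

lemma slopeMap_false (n τ : ℝ) : slopeMap n false τ = τ / (n * (1 - τ) + 2 * τ) := rfl
lemma slopeMap_true (n τ : ℝ) :
    slopeMap n true τ = ((1 - τ) + n * τ) / (2 * (1 - τ) + n * τ) := rfl
lemma stretch_false (n τ : ℝ) : stretch n false τ = (n * (1 - τ) + 2 * τ) / (n + 2) := rfl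
lemma stretch_true (n τ : ℝ) : stretch n true τ = (2 * (1 - τ) + n * τ) / (n + 2) := rfl

variable {n : ℝ}

lemma two_le_weight (hn : 2 ≤ n) {τ : ℝ} (hτ : τ ∈ Icc (0 : ℝ) 1) :
    2 ≤ n * (1 - τ) + 2 * τ := by
  nlinarith [hτ.1, hτ.2]

lemma two_le_weight' (hn : 2 ≤ n) {τ : ℝ} (hτ : τ ∈ Icc (0 : ℝ) 1) :
    2 ≤ 2 * (1 - τ) + n * τ := by
  nlinarith [hτ.1, hτ.2]

lemma one_sub_mem {τ : ℝ} (hτ : τ ∈ Icc (0 : ℝ) 1) : 1 - τ ∈ Icc (0 : ℝ) 1 :=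
  ⟨by linarith [hτ.2], by linarith [hτ.1]⟩

lemma slopeMap_true_eq (hn : 2 ≤ n) {τ : ℝ} (hτ : τ ∈ Icc (0 : ℝ) 1) :
    slopeMap n true τ = 1 - slopeMap n false (1 - τ) := by
  have h := two_le_weight' hn hτ
  rw [slopeMap_true, slopeMap_false, eq_sub_iff_add_eq,
    show n * (1 - (1 - τ)) + 2 * (1 - τ) = 2 * (1 - τ) + n * τ by ring, ← add_div,
    div_eq_one_iff_eq (by positivity)]
  ring

lemma slopeMap_false_mem (hn : 2 ≤ n) {τ : ℝ} (hτ : τ ∈ Icc (0 : ℝ) 1) :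
    slopeMap n false τ ∈ Icc (0 : ℝ) (1 / 2) := by
  have h := two_le_weight hn hτ
  rw [slopeMap_false]
  refine ⟨div_nonneg hτ.1 (by linarith), ?_⟩
  rw [div_le_iff₀ (by linarith)]
  nlinarith [hτ.1, hτ.2]

lemma slopeMap_true_mem (hn : 2 ≤ n) {τ : ℝ} (hτ : τ ∈ Icc (0 : ℝ) 1) :
    slopeMap n true τ ∈ Icc (1 / 2 : ℝ) 1 := by
  have h := slopeMap_false_mem hn (one_sub_mem hτ)
  rw [slopeMap_true_eq hn hτ]
  constructor <;> linarith [h.1, h.2]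

lemma slopeMap_mem (hn : 2 ≤ n) (b : Bool) {τ : ℝ} (hτ : τ ∈ Icc (0 : ℝ) 1) :
    slopeMap n b τ ∈ Icc (0 : ℝ) 1 := by
  cases b
  · exact Icc_subset_Icc_right (by norm_num) (slopeMap_false_mem hn hτ)
  · exact Icc_subset_Icc_left (by norm_num) (slopeMap_true_mem hn hτ)

@[simp] lemma slopeMap_true_zero : slopeMap n true 0 = 1 / 2 := by simp [slopeMap_true]

lemma stretch_pos (hn : 2 ≤ n) (b : Bool) {τ : ℝ} (hτ : τ ∈ Icc (0 : ℝ) 1) :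
    0 < stretch n b τ := by
  cases b
  · exact div_pos (by linarith [two_le_weight hn hτ]) (by linarith)
  · exact div_pos (by linarith [two_le_weight' hn hτ]) (by linarith)

lemma planeT_direction (hn : 2 ≤ n) (b : Bool) {τ : ℝ} (hτ : τ ∈ Icc (0 : ℝ) 1) :
    planeT n b (1 - τ, τ) = stretch n b τ • (1 - slopeMap n b τ, slopeMap n b τ) := by
  have h1 := two_le_weight hn hτ
  have h2 := two_le_weight' hn hτ
  have h3 : n + 2 ≠ 0 := by linarith
  cases b
  · simp only [planeT_false, slopeMap_false, stretch_false]
    generalize hD : n * (1 - τ) + 2 * τ = D at h1 ⊢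
    have h4 : D ≠ 0 := by linarith
    ext <;> simp <;> field_simp
    rw [← hD]
    ring
  · simp only [planeT_true, slopeMap_true, stretch_true]
    generalize hD : 2 * (1 - τ) + n * τ = D at h2 ⊢
    have h4 : D ≠ 0 := by linarith
    ext <;> simp <;> field_simp
    rw [← hD]
    ring

/-- Differences of slopes are governed by the determinant `n / (n + 2)²` of `planeT n b`. -/
lemma slopeMap_sub (hn : 2 ≤ n) (b : Bool) {s t : ℝ} (hs : s ∈ Icc (0 : ℝ) 1)
    (ht : t ∈ Icc (0 : ℝ) 1) :
    (slopeMap n b t - slopeMap n b s) * (stretch n b s * stretch n b t) =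
      n / (n + 2) ^ 2 * (t - s) := by
  have h3 : n + 2 ≠ 0 := by linarith
  cases b
  · have h1 : n * (1 - s) + 2 * s ≠ 0 := by linarith [two_le_weight hn hs]
    have h2 : n * (1 - t) + 2 * t ≠ 0 := by linarith [two_le_weight hn ht]
    simp only [slopeMap_false, stretch_false]
    generalize hD : n * (1 - s) + 2 * s = D at h1 ⊢
    generalize hE : n * (1 - t) + 2 * t = E at h2 ⊢
    field_simp
    rw [← hD, ← hE]
    ring
  · have h1 : 2 * (1 - s) + n * s ≠ 0 := by linarith [two_le_weight' hn hs]
    have h2 : 2 * (1 - t) + n * t ≠ 0 := by linarith [two_le_weight' hn ht]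
    simp only [slopeMap_true, stretch_true]
    generalize hD : 2 * (1 - s) + n * s = D at h1 ⊢
    generalize hE : 2 * (1 - t) + n * t = E at h2 ⊢
    field_simp
    rw [← hD, ← hE]
    ring

lemma slopeMap_le (hn : 2 ≤ n) (b : Bool) {s t : ℝ} (hs : s ∈ Icc (0 : ℝ) 1)
    (ht : t ∈ Icc (0 : ℝ) 1) (hst : s ≤ t) : slopeMap n b s ≤ slopeMap n b t := by
  have h := slopeMap_sub hn b hs ht
  have h1 := mul_pos (stretch_pos hn b hs) (stretch_pos hn b ht)
  have h2 : 0 ≤ n / (n + 2) ^ 2 * (t - s) := mul_nonneg (by positivity) (by linarith)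
  rw [← h] at h2
  linarith [nonneg_of_mul_nonneg_left h2 h1]

/-- A continuous left inverse of `slopeMap n false`, constant equal to `1` to the right of `1 / 2`
and to `0` to the left of `0`. -/
noncomputable def slopeInv (n τ : ℝ) : ℝ :=
  n * max 0 (min τ (1 / 2)) / (1 + (n - 2) * max 0 (min τ (1 / 2)))

lemma slopeInv_den_pos (hn : 2 ≤ n) (τ : ℝ) : 0 < 1 + (n - 2) * max 0 (min τ (1 / 2)) := by
  have : 0 ≤ max 0 (min τ (1 / 2)) := le_max_left _ _
  nlinarith

lemma continuous_slopeInv (hn : 2 ≤ n) : Continuous (slopeInv n) := by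
  unfold slopeInv
  exact Continuous.div (by fun_prop) (by fun_prop) fun τ => (slopeInv_den_pos hn τ).ne'

lemma slopeInv_mem (hn : 2 ≤ n) (τ : ℝ) : slopeInv n τ ∈ Icc (0 : ℝ) 1 := by
  have h := slopeInv_den_pos hn τ
  have h0 : 0 ≤ max 0 (min τ (1 / 2)) := le_max_left _ _
  have h1 : max 0 (min τ (1 / 2)) ≤ 1 / 2 := max_le (by norm_num) (min_le_right _ _)
  unfold slopeInv
  refine ⟨div_nonneg (mul_nonneg (by linarith) h0) h.le, ?_⟩
  rw [div_le_one h]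
  linarith

lemma slopeInv_of_ge (hn : 2 ≤ n) {τ : ℝ} (hτ : 1 / 2 ≤ τ) : slopeInv n τ = 1 := by
  unfold slopeInv
  rw [min_eq_right hτ, max_eq_right (by norm_num), div_eq_one_iff_eq (by linarith)]
  ring

lemma slopeInv_of_mem {τ : ℝ} (hτ : τ ∈ Icc (0 : ℝ) (1 / 2)) :
    slopeInv n τ = n * τ / (1 + (n - 2) * τ) := by
  unfold slopeInv
  rw [min_eq_left hτ.2, max_eq_right hτ.1]

lemma slopeInv_zero : slopeInv n 0 = 0 := by
  rw [slopeInv_of_mem ⟨le_rfl, by norm_num⟩]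
  simp

lemma slopeMap_slopeInv (hn : 2 ≤ n) {τ : ℝ} (hτ : τ ∈ Icc (0 : ℝ) (1 / 2)) :
    slopeMap n false (slopeInv n τ) = τ := by
  have h : 1 + (n - 2) * τ ≠ 0 := by nlinarith [hτ.1, hτ.2]
  have h2 := two_le_weight hn (slopeInv_mem hn τ)
  rw [slopeMap_false, div_eq_iff (by linarith), slopeInv_of_mem hτ]
  generalize hD : 1 + (n - 2) * τ = D at h ⊢
  field_simp
  rw [← hD]
  ring

lemma slopeMap_injOn (hn : 2 ≤ n) (b : Bool) : InjOn (slopeMap n b) (Icc 0 1) := by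
  intro s hs t ht hst
  have h := slopeMap_sub hn b hs ht
  rw [hst, sub_self, zero_mul, eq_comm, mul_eq_zero] at h
  rcases h with h | h
  · have : 0 < n / (n + 2) ^ 2 := by positivity
    exact absurd h this.ne'
  · linarith

lemma slopeInv_slopeMap (hn : 2 ≤ n) {τ : ℝ} (hτ : τ ∈ Icc (0 : ℝ) 1) :
    slopeInv n (slopeMap n false τ) = τ :=
  slopeMap_injOn hn false (slopeInv_mem hn _) hτ
    (slopeMap_slopeInv hn (slopeMap_false_mem hn hτ))

lemma slopeMap_slopeInv_true (hn : 2 ≤ n) {τ : ℝ} (hτ : τ ∈ Icc (1 / 2 : ℝ) 1) :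
    slopeMap n true (1 - slopeInv n (1 - τ)) = τ := by
  rw [slopeMap_true_eq hn (one_sub_mem (slopeInv_mem hn _)), sub_sub_cancel,
    slopeMap_slopeInv hn ⟨by linarith [hτ.2], by linarith [hτ.1]⟩]
  ring

lemma slopeInv_slopeMap_true (hn : 2 ≤ n) {τ : ℝ} (hτ : τ ∈ Icc (0 : ℝ) 1) :
    1 - slopeInv n (1 - slopeMap n true τ) = τ := by
  rw [slopeMap_true_eq hn hτ, sub_sub_cancel, slopeInv_slopeMap hn (one_sub_mem hτ)]
  ring

/-- Every slope is the image of a slope under one of the two maps. -/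
lemma exists_slopeMap_eq (hn : 2 ≤ n) {τ : ℝ} (hτ : τ ∈ Icc (0 : ℝ) 1) :
    ∃ b, ∃ u ∈ Icc (0 : ℝ) 1, slopeMap n b u = τ := by
  rcases le_total τ (1 / 2) with h | h
  · exact ⟨false, _, slopeInv_mem hn τ, slopeMap_slopeInv hn ⟨hτ.1, h⟩⟩
  · exact ⟨true, _, one_sub_mem (slopeInv_mem hn _), slopeMap_slopeInv_true hn ⟨h, hτ.2⟩⟩

/-! ### Cones of directions -/

/-- The cone of the vectors with direction between `(1 - s, s)` and `(1 - t, t)`. -/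
structure Chord (s t : ℝ) (z : ℝ × ℝ) : Prop where
  fst_nonneg : 0 ≤ z.1
  snd_nonneg : 0 ≤ z.2
  left : s * z.1 ≤ (1 - s) * z.2
  right : (1 - t) * z.2 ≤ t * z.1

lemma Chord.zero (s t : ℝ) : Chord s t 0 := ⟨by simp, by simp, by simp, by simp⟩

lemma Chord.add {s m t : ℝ} {y z : ℝ × ℝ} (hsm : s ≤ m) (hmt : m ≤ t) (hy : Chord s m y)
    (hz : Chord m t z) : Chord s t (y + z) := by
  obtain ⟨h1, h2, h3, h4⟩ := hy
  obtain ⟨k1, k2, k3, k4⟩ := hz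
  refine ⟨add_nonneg h1 k1, add_nonneg h2 k2, ?_, ?_⟩ <;> simp only [Prod.fst_add, Prod.snd_add]
  · nlinarith [mul_nonneg (sub_nonneg.2 hsm) k1, mul_nonneg (sub_nonneg.2 hsm) k2]
  · nlinarith [mul_nonneg (sub_nonneg.2 hmt) h1, mul_nonneg (sub_nonneg.2 hmt) h2]

lemma Chord.planeT (hn : 2 ≤ n) (b : Bool) {s t : ℝ} (hs : s ∈ Icc (0 : ℝ) 1)
    (ht : t ∈ Icc (0 : ℝ) 1) {z : ℝ × ℝ} (h : Chord s t z) :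
    Chord (slopeMap n b s) (slopeMap n b t) (planeT n b z) := by
  obtain ⟨h1, h2, h3, h4⟩ := h
  have hn2 : 0 < n + 2 := by linarith
  have hn0 : 0 ≤ n := by linarith
  have key : ∀ {x y D : ℝ}, 0 < D → x ≤ y → x / D ≤ y / D := fun hD hxy =>
    div_le_div_of_nonneg_right hxy hD.le
  cases b
  · have hs2 : 0 < n * (1 - s) + 2 * s := by linarith [two_le_weight hn hs]
    have ht2 : 0 < n * (1 - t) + 2 * t := by linarith [two_le_weight hn ht]
    refine ⟨?_, ?_, ?_, ?_⟩ <;> simp only [planeT_false, slopeMap_false]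
    · positivity
    · positivity
    · rw [one_sub_div hs2.ne', div_mul_div_comm, div_mul_div_comm]
      refine key (by positivity) ?_
      nlinarith
    · rw [one_sub_div ht2.ne', div_mul_div_comm, div_mul_div_comm]
      refine key (by positivity) ?_
      nlinarith
  · have hs2 : 0 < 2 * (1 - s) + n * s := by linarith [two_le_weight' hn hs]
    have ht2 : 0 < 2 * (1 - t) + n * t := by linarith [two_le_weight' hn ht]
    refine ⟨?_, ?_, ?_, ?_⟩ <;> simp only [planeT_true, slopeMap_true]
    · positivity
    · positivity
    · rw [one_sub_div hs2.ne', div_mul_div_comm, div_mul_div_comm]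
      refine key (by positivity) ?_
      nlinarith
    · rw [one_sub_div ht2.ne', div_mul_div_comm, div_mul_div_comm]
      refine key (by positivity) ?_
      nlinarith

lemma planeS_sub (b : Bool) (y z : ℝ × ℝ) :
    planeS n b y - planeS n b z = planeT n b (y - z) := by
  simp only [planeS, ← map_sub, add_sub_add_right_eq_sub, sub_sub_sub_cancel_right]

lemma norm_planeT_le (hn : 2 ≤ n) (b : Bool) (z : ℝ × ℝ) :
    ‖planeT n b z‖ ≤ (n + 1) / (n + 2) * ‖z‖ := by
  have h1 : |z.1| ≤ ‖z‖ := norm_fst_le z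
  have h2 : |z.2| ≤ ‖z‖ := norm_snd_le z
  have h3 : 0 ≤ ‖z‖ := norm_nonneg z
  have hn2 : 0 < n + 2 := by linarith
  have hn0 : 0 ≤ n := by linarith
  obtain ⟨a1, a2⟩ := abs_le.1 h1
  obtain ⟨c1, c2⟩ := abs_le.1 h2
  rw [div_mul_eq_mul_div]
  cases b
  · refine max_le ?_ ?_ <;>
      simp only [planeT_false, Real.norm_eq_abs, abs_div, abs_of_pos hn2] <;>
      refine div_le_div_of_nonneg_right (abs_le.2 ⟨?_, ?_⟩) hn2.le <;> nlinarith
  · refine max_le ?_ ?_ <;>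
      simp only [planeT_true, Real.norm_eq_abs, abs_div, abs_of_pos hn2] <;>
      refine div_le_div_of_nonneg_right (abs_le.2 ⟨?_, ?_⟩) hn2.le <;> nlinarith

@[simp] lemma planeS_planeV (b : Bool) : planeS n b (planeV b) = planeV b := by
  simp [planeS]

/-- The two pieces of the curve meet. -/
lemma planeS_false_planeV_true (hn : 2 ≤ n) :
    planeS n false (planeV true) = planeS n true (planeV false) := by
  have : n + 2 ≠ 0 := by linarith
  ext <;> simp [planeS] <;> field_simp <;> ring

/-! ### The curve parametrized by its slope -/

/-- `P` parametrizes the curve by its slope: it is equivariant under the two pairs of maps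
`slopeMap n b` and `planeS n b`, and the direction of the chord from `P s` to `P t` lies between
`s` and `t`. -/
structure IsSlopeParam (n : ℝ) (P : ℝ → ℝ × ℝ) : Prop where
  continuous : Continuous P
  map_zero : P 0 = planeV false
  map_one : P 1 = planeV true
  chord : ∀ s ∈ Icc (0 : ℝ) 1, ∀ t ∈ Icc (0 : ℝ) 1, s ≤ t → Chord s t (P t - P s)
  map_slopeMap : ∀ b, ∀ u ∈ Icc (0 : ℝ) 1, P (slopeMap n b u) = planeS n b (P u)

lemma lipschitzWith_planeS (hn : 2 ≤ n) (b : Bool) :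
    LipschitzWith (Real.toNNReal ((n + 1) / (n + 2))) (planeS n b) := by
  refine LipschitzWith.of_dist_le_mul fun y z => ?_
  rw [dist_eq_norm, planeS_sub, dist_eq_norm, Real.coe_toNNReal _ (by positivity)]
  exact norm_planeT_le hn b _

open BoundedContinuousFunction in
/-- The operator whose fixed point is the curve. At each slope at least one of the two first terms
equals the last one, for functions with the right end points. -/
noncomputable def curveOp (hn : 2 ≤ n) (P : ℝ →ᵇ ℝ × ℝ) : ℝ →ᵇ ℝ × ℝ :=
  (P.compContinuous ⟨slopeInv n, continuous_slopeInv hn⟩).comp (planeS n false)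
      (lipschitzWith_planeS hn false)
    + (P.compContinuous ⟨fun τ => 1 - slopeInv n (1 - τ), continuous_const.sub
        ((continuous_slopeInv hn).comp (continuous_const.sub continuous_id))⟩).comp
      (planeS n true) (lipschitzWith_planeS hn true)
    - BoundedContinuousFunction.const ℝ (planeS n true (planeV false))

open BoundedContinuousFunction in
lemma curveOp_apply (hn : 2 ≤ n) (P : ℝ →ᵇ ℝ × ℝ) (τ : ℝ) :
    curveOp hn P τ = planeS n false (P (slopeInv n τ)) +
      planeS n true (P (1 - slopeInv n (1 - τ))) - planeS n true (planeV false) := rfl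

open BoundedContinuousFunction in
/-- The bounded continuous functions with the end points and the chords of the curve. -/
def curveSpace : Set (ℝ →ᵇ ℝ × ℝ) :=
  {P | P 0 = planeV false ∧ P 1 = planeV true ∧
    ∀ s ∈ Icc (0 : ℝ) 1, ∀ t ∈ Icc (0 : ℝ) 1, s ≤ t → Chord s t (P t - P s)}

lemma isClosed_chord (s t : ℝ) : IsClosed {z : ℝ × ℝ | Chord s t z} := by
  have : {z : ℝ × ℝ | Chord s t z} = {z | 0 ≤ z.1} ∩ {z | 0 ≤ z.2} ∩
      {z | s * z.1 ≤ (1 - s) * z.2} ∩ {z | (1 - t) * z.2 ≤ t * z.1} := by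
    ext z
    exact ⟨fun h => ⟨⟨⟨h.1, h.2⟩, h.3⟩, h.4⟩, fun h => ⟨h.1.1.1, h.1.1.2, h.1.2, h.2⟩⟩
  rw [this]
  refine ((IsClosed.inter ?_ ?_).inter ?_).inter ?_ <;>
    exact isClosed_le (by fun_prop) (by fun_prop)

lemma isClosed_curveSpace : IsClosed curveSpace := by
  have hev : ∀ x : ℝ, Continuous fun P : BoundedContinuousFunction ℝ (ℝ × ℝ) => P x := fun x =>
    continuous_eval_const x
  have : curveSpace = {P : BoundedContinuousFunction ℝ (ℝ × ℝ) | P 0 = planeV false} ∩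
      ({P | P 1 = planeV true} ∩ ⋂ (s : ℝ) (_ : s ∈ Icc (0 : ℝ) 1) (t : ℝ)
      (_ : t ∈ Icc (0 : ℝ) 1) (_ : s ≤ t), {P | Chord s t (P t - P s)}) := by
    ext P
    simp only [mem_inter_iff, mem_iInter]
    rfl
  rw [this]
  refine (isClosed_eq (hev 0) continuous_const).inter
    ((isClosed_eq (hev 1) continuous_const).inter ?_)
  exact isClosed_iInter fun s => isClosed_iInter fun _ => isClosed_iInter fun t =>
    isClosed_iInter fun _ => isClosed_iInter fun _ =>
      (isClosed_chord s t).preimage ((hev t).sub (hev s))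

lemma curveOp_of_le (hn : 2 ≤ n) {P : BoundedContinuousFunction ℝ (ℝ × ℝ)}
    (hP : P ∈ curveSpace) {τ : ℝ} (hτ : τ ≤ 1 / 2) :
    curveOp hn P τ = planeS n false (P (slopeInv n τ)) := by
  rw [curveOp_apply, slopeInv_of_ge hn (by linarith : 1 / 2 ≤ 1 - τ), sub_self, hP.1]
  abel

lemma curveOp_of_ge (hn : 2 ≤ n) {P : BoundedContinuousFunction ℝ (ℝ × ℝ)}
    (hP : P ∈ curveSpace) {τ : ℝ} (hτ : 1 / 2 ≤ τ) :
    curveOp hn P τ = planeS n true (P (1 - slopeInv n (1 - τ))) := by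
  rw [curveOp_apply, slopeInv_of_ge hn hτ, hP.2.1, planeS_false_planeV_true hn]
  abel

lemma slopeInv_mono (hn : 2 ≤ n) {s t : ℝ} (hst : s ≤ t) (hs : s ∈ Icc (0 : ℝ) (1 / 2))
    (ht : t ∈ Icc (0 : ℝ) (1 / 2)) : slopeInv n s ≤ slopeInv n t := by
  by_contra! h
  have h1 := slopeMap_le hn false (slopeInv_mem hn t) (slopeInv_mem hn s) h.le
  rw [slopeMap_slopeInv hn hs, slopeMap_slopeInv hn ht] at h1
  rw [le_antisymm hst h1] at h
  exact lt_irrefl _ h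

lemma curveOp_mem (hn : 2 ≤ n) {P : BoundedContinuousFunction ℝ (ℝ × ℝ)}
    (hP : P ∈ curveSpace) : curveOp hn P ∈ curveSpace := by
  have low : ∀ s ∈ Icc (0 : ℝ) (1 / 2), ∀ t ∈ Icc (0 : ℝ) (1 / 2), s ≤ t →
      Chord s t (curveOp hn P t - curveOp hn P s) := by
    intro s hs t ht hst
    rw [curveOp_of_le hn hP hs.2, curveOp_of_le hn hP ht.2, planeS_sub]
    have := (hP.2.2 _ (slopeInv_mem hn s) _ (slopeInv_mem hn t)
      (slopeInv_mono hn hst hs ht)).planeT hn false (slopeInv_mem hn s) (slopeInv_mem hn t)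
    rwa [slopeMap_slopeInv hn hs, slopeMap_slopeInv hn ht] at this
  have high : ∀ s ∈ Icc (1 / 2 : ℝ) 1, ∀ t ∈ Icc (1 / 2 : ℝ) 1, s ≤ t →
      Chord s t (curveOp hn P t - curveOp hn P s) := by
    intro s hs t ht hst
    rw [curveOp_of_ge hn hP hs.1, curveOp_of_ge hn hP ht.1, planeS_sub]
    have h1 := slopeInv_mono hn (sub_le_sub_left hst 1) ⟨by linarith [ht.2], by linarith [ht.1]⟩
      ⟨by linarith [hs.2], by linarith [hs.1]⟩
    have hs' := one_sub_mem (slopeInv_mem hn (1 - s))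
    have ht' := one_sub_mem (slopeInv_mem hn (1 - t))
    have := (hP.2.2 _ hs' _ ht' (by linarith)).planeT hn true hs' ht'
    rwa [slopeMap_slopeInv_true hn hs, slopeMap_slopeInv_true hn ht] at this
  refine ⟨?_, ?_, ?_⟩
  · rw [curveOp_of_le hn hP (by norm_num), slopeInv_zero, hP.1, planeS_planeV]
  · rw [curveOp_of_ge hn hP (by norm_num), sub_self, slopeInv_zero, sub_zero, hP.2.1,
      planeS_planeV]
  · intro s hs t ht hst
    rcases le_total t (1 / 2) with h | h
    · exact low s ⟨hs.1, hst.trans h⟩ t ⟨ht.1, h⟩ hst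
    rcases le_total s (1 / 2) with h' | h'
    · have h1 := low s ⟨hs.1, h'⟩ (1 / 2) ⟨by norm_num, le_rfl⟩ h'
      have h2 := high (1 / 2) ⟨le_rfl, by norm_num⟩ t ⟨h, ht.2⟩ h
      have := h1.add h' h h2
      rwa [add_comm, sub_add_sub_cancel] at this
    · exact high s ⟨h', hs.2⟩ t ⟨h, ht.2⟩ hst

/-- The parabola `τ ↦ (-(1 - τ)², τ²)` lies in the space of curves. -/
lemma curveSpace_nonempty : curveSpace.Nonempty := by
  have hb : ∀ τ : ℝ, ‖((-(1 - max 0 (min τ 1)) ^ 2, (max 0 (min τ 1)) ^ 2) : ℝ × ℝ)‖ ≤ 1 := by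
    intro τ
    have h0 : 0 ≤ max 0 (min τ 1) := le_max_left _ _
    have h1 : max 0 (min τ 1) ≤ 1 := max_le (by norm_num) (min_le_right _ _)
    refine max_le ?_ ?_ <;> simp only [Real.norm_eq_abs] <;> rw [abs_le] <;>
      constructor <;> nlinarith
  refine ⟨BoundedContinuousFunction.ofNormedAddCommGroup _ (by fun_prop) 1 hb, ?_, ?_, ?_⟩
  · simp
  · simp
  · intro s hs t ht hst
    simp only [BoundedContinuousFunction.coe_ofNormedAddCommGroup, min_eq_left hs.2,
      max_eq_right hs.1, min_eq_left ht.2, max_eq_right ht.1]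
    obtain ⟨hs0, hs1⟩ := hs
    obtain ⟨ht0, ht1⟩ := ht
    refine ⟨?_, ?_, ?_, ?_⟩ <;> simp only [Prod.fst_sub, Prod.snd_sub]
    · nlinarith
    · nlinarith
    · nlinarith [sq_nonneg (t - s)]
    · nlinarith [sq_nonneg (t - s)]

theorem exists_isSlopeParam (hn : 2 ≤ n) : ∃ P, IsSlopeParam n P := by
  have hmaps : MapsTo (curveOp hn) curveSpace curveSpace := fun P hP => curveOp_mem hn hP
  have hK : Real.toNNReal ((n + 1) / (n + 2)) < 1 := by
    rw [Real.toNNReal_lt_one, div_lt_one (by linarith)]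
    linarith
  have hlip : ∀ b x y, dist (planeS n b x) (planeS n b y) ≤
      Real.toNNReal ((n + 1) / (n + 2)) * dist x y := fun b x y =>
    (lipschitzWith_planeS hn b).dist_le_mul x y
  have hcontr : ContractingWith (Real.toNNReal ((n + 1) / (n + 2)))
      (hmaps.restrict (curveOp hn) curveSpace curveSpace) := by
    refine ⟨hK, LipschitzWith.of_dist_le_mul fun P Q => ?_⟩
    refine (BoundedContinuousFunction.dist_le (by positivity)).2 fun τ => ?_
    have hPQ : ∀ x, dist (P.1 x) (Q.1 x) ≤ dist P Q := fun x =>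
      BoundedContinuousFunction.dist_coe_le_dist x
    simp only [MapsTo.val_restrict_apply]
    rcases le_total τ (1 / 2) with h | h
    · rw [curveOp_of_le hn P.2 h, curveOp_of_le hn Q.2 h]
      exact (hlip _ _ _).trans (mul_le_mul_of_nonneg_left (hPQ _) (by positivity))
    · rw [curveOp_of_ge hn P.2 h, curveOp_of_ge hn Q.2 h]
      exact (hlip _ _ _).trans (mul_le_mul_of_nonneg_left (hPQ _) (by positivity))
  obtain ⟨P₀, hP₀⟩ := curveSpace_nonempty
  obtain ⟨P, hP, hfix, -⟩ := hcontr.exists_fixedPoint' isClosed_curveSpace.isComplete hmaps hP₀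
    (edist_ne_top _ _)
  refine ⟨P, P.continuous, hP.1, hP.2.1, hP.2.2, fun b u hu => ?_⟩
  have hfix' : ∀ τ, P τ = curveOp hn P τ := fun τ => by rw [hfix.eq]
  cases b
  · rw [hfix', curveOp_of_le hn hP (slopeMap_false_mem hn hu).2, slopeInv_slopeMap hn hu]
  · rw [hfix', curveOp_of_ge hn hP (slopeMap_true_mem hn hu).1, slopeInv_slopeMap_true hn hu]

/-! ### Words -/

/-- The product `T_{v_1} ⋯ T_{v_m}` in the plane. The word is listed from its last letter `v_m`
to its first letter `v_1`, so that prolonging a word is `List.cons`. -/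
noncomputable def wordT (n : ℝ) : List Bool → (ℝ × ℝ) →ₗ[ℝ] ℝ × ℝ
  | [] => LinearMap.id
  | b :: v => (wordT n v).comp (planeT n b)

/-- The composition `S_{v_1} ∘ ⋯ ∘ S_{v_m}` in the plane, with the convention of `wordT`. -/
noncomputable def wordS (n : ℝ) : List Bool → ℝ × ℝ → ℝ × ℝ
  | [] => id
  | b :: v => wordS n v ∘ planeS n b

/-- The action of `wordT` on slopes. -/
noncomputable def wordSlope (n : ℝ) : List Bool → ℝ → ℝ
  | [] => id
  | b :: v => wordSlope n v ∘ slopeMap n b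

/-- `(n + 2) ^ m` times the sums of the coordinates of the images of `(1, 0)` and of `(0, 1)`
under `wordT n v`, where `m` is the length of `v`. -/
noncomputable def weight (n : ℝ) : List Bool → ℝ × ℝ
  | [] => (1, 1)
  | b :: v => bif b then ((weight n v).1 + (weight n v).2, n * (weight n v).2)
      else (n * (weight n v).1, (weight n v).1 + (weight n v).2)

/-- The factor by which `wordT n v` stretches `(1 - u, u)`. -/
noncomputable def wordStretch (n : ℝ) (v : List Bool) (u : ℝ) : ℝ :=
  ((1 - u) * (weight n v).1 + u * (weight n v).2) / (n + 2) ^ v.length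

/-- The largest eigenvalue `λ` of `(n + 2) T_1` followed by the symmetry exchanging `p_1` and
`p_2`. -/
noncomputable def growth (n : ℝ) : ℝ := (1 + √(4 * n + 1)) / 2

lemma growth_sq (hn : 2 ≤ n) : growth n ^ 2 = growth n + n := by
  have := Real.sq_sqrt (by linarith : 0 ≤ 4 * n + 1)
  unfold growth
  linear_combination this / 4

lemma two_le_growth (hn : 2 ≤ n) : 2 ≤ growth n := by
  have : 3 ≤ √(4 * n + 1) := Real.le_sqrt_of_sq_le (by linarith)
  unfold growth
  linarith

lemma growth_le (hn : 2 ≤ n) : growth n ≤ n := by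
  nlinarith [growth_sq hn, two_le_growth hn]

lemma weight_pos (hn : 2 ≤ n) (v : List Bool) : 0 < (weight n v).1 ∧ 0 < (weight n v).2 := by
  induction v with
  | nil => simp [weight]
  | cons b v ih =>
    have : 0 < n := by linarith
    obtain ⟨h1, h2⟩ := ih
    cases b <;> simp only [weight, cond_true, cond_false] <;> constructor <;> positivity

/-- The two weights of a word are comparable. -/
lemma weight_le (hn : 2 ≤ n) (v : List Bool) :
    (weight n v).1 ≤ (n - 1) * (weight n v).2 ∧ (weight n v).2 ≤ (n - 1) * (weight n v).1 := by
  induction v with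
  | nil => simp only [weight]; constructor <;> linarith
  | cons b v ih =>
    obtain ⟨h1, h2⟩ := ih
    obtain ⟨k1, k2⟩ := weight_pos hn v
    cases b <;> simp only [weight, cond_true, cond_false] <;> constructor <;> nlinarith

/-- The weights grow at least like `growth n ^ m`; the two functionals on the right are
eigenfunctionals of the two letters followed by the exchange of the coordinates. -/
lemma pow_le_weight (hn : 2 ≤ n) (v : List Bool) :
    (growth n + 1) * growth n ^ v.length ≤ growth n * (weight n v).2 + (weight n v).1 ∧
    (growth n + 1) * growth n ^ v.length ≤ (weight n v).2 + growth n * (weight n v).1 := by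
  have hl := growth_sq hn
  have hl2 := two_le_growth hn
  induction v with
  | nil => simp only [weight, List.length_nil]; constructor <;> linarith
  | cons b v ih =>
    obtain ⟨h1, h2⟩ := ih
    obtain ⟨k1, k2⟩ := weight_le hn v
    have l0 : 0 ≤ growth n := by linarith
    have h1' := mul_le_mul_of_nonneg_left h1 l0
    have h2' := mul_le_mul_of_nonneg_left h2 l0
    have h3 := mul_le_mul_of_nonneg_left k1 (by linarith : 0 ≤ growth n - 1)
    have h4 := mul_le_mul_of_nonneg_left k2 (by linarith : 0 ≤ growth n - 1)
    have e1 : growth n ^ 2 * (weight n v).1 = (growth n + n) * (weight n v).1 := by rw [hl]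
    have e2 : growth n ^ 2 * (weight n v).2 = (growth n + n) * (weight n v).2 := by rw [hl]
    have e : (growth n + 1) * growth n ^ (v.length + 1) =
      growth n * ((growth n + 1) * growth n ^ v.length) := by ring
    cases b <;> simp only [weight, cond_true, cond_false, List.length_cons, e] <;>
      constructor <;> linarith

lemma pow_le_weight_add (hn : 2 ≤ n) (v : List Bool) :
    growth n ^ v.length ≤ (weight n v).1 + (weight n v).2 := by
  have hl2 := two_le_growth hn
  obtain ⟨h1, h2⟩ := pow_le_weight hn v
  have h3 : 0 ≤ (growth n + 1) * growth n ^ v.length := by positivity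
  refine le_of_mul_le_mul_left ?_ (by linarith : 0 < growth n + 1)
  linarith

lemma wordT_add (hn : 2 ≤ n) (v : List Bool) (z : ℝ × ℝ) :
    (wordT n v z).1 + (wordT n v z).2 =
      (z.1 * (weight n v).1 + z.2 * (weight n v).2) / (n + 2) ^ v.length := by
  have h3 : n + 2 ≠ 0 := by linarith
  induction v generalizing z with
  | nil => simp [wordT, weight]
  | cons b v ih =>
    rw [wordT, LinearMap.comp_apply, ih]
    cases b <;> simp only [weight, cond_true, cond_false, List.length_cons, planeT_false,
      planeT_true] <;> field_simp <;> ring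

lemma wordSlope_mem (hn : 2 ≤ n) (v : List Bool) {u : ℝ} (hu : u ∈ Icc (0 : ℝ) 1) :
    wordSlope n v u ∈ Icc (0 : ℝ) 1 := by
  induction v generalizing u with
  | nil => exact hu
  | cons b v ih => exact ih (slopeMap_mem hn b hu)

lemma wordT_direction (hn : 2 ≤ n) (v : List Bool) {u : ℝ} (hu : u ∈ Icc (0 : ℝ) 1) :
    wordT n v (1 - u, u) = wordStretch n v u • (1 - wordSlope n v u, wordSlope n v u) := by
  have key : ∃ c : ℝ, wordT n v (1 - u, u) = c • (1 - wordSlope n v u, wordSlope n v u) := by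
    induction v generalizing u with
    | nil => exact ⟨1, by simp [wordT, wordSlope]⟩
    | cons b v ih =>
      obtain ⟨c, hc⟩ := ih (slopeMap_mem hn b hu)
      refine ⟨stretch n b u * c, ?_⟩
      rw [wordT, LinearMap.comp_apply, planeT_direction hn b hu, map_smul, hc, smul_smul]
      rfl
  obtain ⟨c, hc⟩ := key
  have h := wordT_add hn v (1 - u, u)
  rw [hc] at h ⊢
  simp only [Prod.smul_fst, Prod.smul_snd, smul_eq_mul, ← mul_add, sub_add_cancel, mul_one] at h
  rw [h, wordStretch]

lemma wordStretch_cons (hn : 2 ≤ n) (b : Bool) (v : List Bool) {u : ℝ}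
    (hu : u ∈ Icc (0 : ℝ) 1) :
    wordStretch n (b :: v) u = stretch n b u * wordStretch n v (slopeMap n b u) := by
  have h1 := wordT_add hn (b :: v) (1 - u, u)
  rw [wordT, LinearMap.comp_apply, planeT_direction hn b hu, map_smul,
    wordT_direction hn v (slopeMap_mem hn b hu)] at h1
  simp only [Prod.smul_fst, Prod.smul_snd, smul_eq_mul, ← mul_add, sub_add_cancel, mul_one] at h1
  rw [wordStretch, ← h1]

lemma le_wordStretch (hn : 2 ≤ n) (v : List Bool) {u : ℝ} (hu : u ∈ Icc (0 : ℝ) 1) :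
    ((weight n v).1 + (weight n v).2) / (n * (n + 2) ^ v.length) ≤ wordStretch n v u := by
  obtain ⟨k1, k2⟩ := weight_le hn v
  rw [wordStretch, ← div_div]
  refine div_le_div_of_nonneg_right ?_ (by positivity)
  rw [div_le_iff₀ (by linarith)]
  nlinarith [mul_le_mul_of_nonneg_left k1 hu.1,
    mul_le_mul_of_nonneg_left k2 (by linarith [hu.2] : 0 ≤ 1 - u)]

lemma wordSlope_sub_mul (hn : 2 ≤ n) (v : List Bool) {s t : ℝ} (hs : s ∈ Icc (0 : ℝ) 1)
    (ht : t ∈ Icc (0 : ℝ) 1) :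
    (wordSlope n v t - wordSlope n v s) * (wordStretch n v s * wordStretch n v t) =
      (n / (n + 2) ^ 2) ^ v.length * (t - s) := by
  induction v generalizing s t with
  | nil => simp [wordSlope, wordStretch, weight]
  | cons b v ih =>
    have h1 := ih (slopeMap_mem hn b hs) (slopeMap_mem hn b ht)
    have h2 := slopeMap_sub hn b hs ht
    rw [wordStretch_cons hn b v hs, wordStretch_cons hn b v ht, List.length_cons]
    simp only [wordSlope, Function.comp_apply]
    linear_combination (stretch n b s * stretch n b t) * h1 +
      (n / (n + 2) ^ 2) ^ v.length * h2

lemma wordSlope_sub_le (hn : 2 ≤ n) (v : List Bool) {s t : ℝ} (hs : s ∈ Icc (0 : ℝ) 1)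
    (ht : t ∈ Icc (0 : ℝ) 1) (hst : s ≤ t) :
    wordSlope n v t - wordSlope n v s ≤
      n ^ 2 * (n / growth n ^ 2) ^ v.length * (t - s) := by
  have hg := two_le_growth hn
  have h := wordSlope_sub_mul hn v hs ht
  have hW := pow_le_weight_add hn v
  have hgm : 0 < growth n ^ v.length := by positivity
  set c := growth n ^ v.length / (n * (n + 2) ^ v.length) with hc
  have hc0 : 0 < c := by positivity
  have hcs : ∀ u ∈ Icc (0 : ℝ) 1, c ≤ wordStretch n v u := fun u hu =>
    (div_le_div_of_nonneg_right hW (by positivity)).trans (le_wordStretch hn v hu)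
  have h2 : c ^ 2 ≤ wordStretch n v s * wordStretch n v t := by
    rw [sq]
    exact mul_le_mul (hcs s hs) (hcs t ht) hc0.le (hc0.le.trans (hcs s hs))
  have h3 : 0 ≤ (n / (n + 2) ^ 2) ^ v.length * (t - s) :=
    mul_nonneg (by positivity) (by linarith)
  have h4 : wordSlope n v t - wordSlope n v s =
      (n / (n + 2) ^ 2) ^ v.length * (t - s) / (wordStretch n v s * wordStretch n v t) := by
    rw [eq_div_iff (by nlinarith), h]
  have h5 : n ^ 2 * (n / growth n ^ 2) ^ v.length * (t - s) =
      (n / (n + 2) ^ 2) ^ v.length * (t - s) / c ^ 2 := by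
    have : n + 2 ≠ 0 := by linarith
    have : n ≠ 0 := by linarith
    have : growth n ≠ 0 := by linarith
    rw [hc, div_pow, div_pow, div_pow, mul_pow, ← pow_mul, ← pow_mul, ← pow_mul, ← pow_mul,
      mul_comm 2 v.length]
    field_simp
  rw [h4, h5]
  exact div_le_div_of_nonneg_left h3 (by positivity) h2

lemma wordSlope_lt (hn : 2 ≤ n) (v : List Bool) {s t : ℝ} (hs : s ∈ Icc (0 : ℝ) 1)
    (ht : t ∈ Icc (0 : ℝ) 1) (hst : s < t) : wordSlope n v s < wordSlope n v t := by
  have h := wordSlope_sub_mul hn v hs ht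
  have h1 : 0 < (n / (n + 2) ^ 2) ^ v.length * (t - s) := mul_pos (by positivity) (by linarith)
  have hpos : ∀ u ∈ Icc (0 : ℝ) 1, 0 < wordStretch n v u := fun u hu =>
    (div_pos (add_pos (weight_pos hn v).1 (weight_pos hn v).2) (by positivity)).trans_le
      (le_wordStretch hn v hu)
  rw [← h] at h1
  linarith [pos_of_mul_pos_left h1 (mul_pos (hpos s hs) (hpos t ht)).le]

lemma growth_ratio_lt_one (hn : 2 ≤ n) : n / growth n ^ 2 < 1 := by
  have := two_le_growth hn
  rw [div_lt_one (by positivity), growth_sq hn]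
  linarith

/-- The cells of slopes of long words are small. -/
lemma tendsto_cell (hn : 2 ≤ n) :
    Tendsto (fun m : ℕ => n ^ 2 * (n / growth n ^ 2) ^ m) atTop (𝓝 0) := by
  have := (tendsto_pow_atTop_nhds_zero_of_lt_one (by positivity)
    (growth_ratio_lt_one hn)).const_mul (n ^ 2)
  rwa [mul_zero] at this

lemma wordSlope_sub_le_cell (hn : 2 ≤ n) (v : List Bool) {s t : ℝ} (hs : s ∈ Icc (0 : ℝ) 1)
    (ht : t ∈ Icc (0 : ℝ) 1) :
    wordSlope n v t - wordSlope n v s ≤ n ^ 2 * (n / growth n ^ 2) ^ v.length := by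
  have h0 : 0 ≤ n ^ 2 * (n / growth n ^ 2) ^ v.length := by positivity
  rcases le_total s t with h | h
  · refine (wordSlope_sub_le hn v hs ht h).trans (mul_le_of_le_one_right h0 ?_)
    linarith [hs.1, ht.2]
  · have h1 : wordSlope n v t ≤ wordSlope n v s := by
      rcases h.eq_or_lt with h | h
      · rw [h]
      · exact (wordSlope_lt hn v ht hs h).le
    linarith

lemma exists_word (hn : 2 ≤ n) (m : ℕ) {s : ℝ} (hs : s ∈ Icc (0 : ℝ) 1) :
    ∃ v : List Bool, v.length = m ∧ ∃ u ∈ Icc (0 : ℝ) 1, wordSlope n v u = s := by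
  induction m with
  | zero => exact ⟨[], rfl, s, hs, rfl⟩
  | succ m ih =>
    obtain ⟨v, hv, u, hu, h⟩ := ih
    obtain ⟨b, u', hu', h'⟩ := exists_slopeMap_eq hn hu
    exact ⟨b :: v, by simp [hv], u', hu', by simp [wordSlope, h', h]⟩

/-- Every interval of slopes contains a cell. -/
lemma exists_cell_subset (hn : 2 ≤ n) {s t : ℝ} (hs : s ∈ Icc (0 : ℝ) 1)
    (ht : t ∈ Icc (0 : ℝ) 1) (hst : s < t) :
    ∃ v : List Bool, ∀ u ∈ Icc (0 : ℝ) 1, wordSlope n v u ∈ Icc s t := by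
  obtain ⟨m, hm⟩ := ((tendsto_cell hn).eventually (gt_mem_nhds (by linarith :
    (0 : ℝ) < (t - s) / 2))).exists
  obtain ⟨v, rfl, u₀, hu₀, h⟩ := exists_word hn m
    (⟨by linarith [hs.1, ht.1], by linarith [hs.2, ht.2]⟩ : (s + t) / 2 ∈ Icc (0 : ℝ) 1)
  refine ⟨v, fun u hu => ?_⟩
  have h1 := wordSlope_sub_le_cell hn v hu₀ hu
  have h2 := wordSlope_sub_le_cell hn v hu hu₀
  constructor <;> linarith

/-- Two different slopes are separated by the vertex `1 / 2` of some common cell. -/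
lemma exists_separating_word (hn : 2 ≤ n) {s t : ℝ} (hs : s ∈ Icc (0 : ℝ) 1)
    (ht : t ∈ Icc (0 : ℝ) 1) (hst : s < t) :
    ∃ v : List Bool, ∃ x ∈ Icc (0 : ℝ) (1 / 2), ∃ y ∈ Icc (1 / 2 : ℝ) 1,
      wordSlope n v x = s ∧ wordSlope n v y = t := by
  by_contra! hcon
  have key : ∀ m, ∃ v : List Bool, v.length = m ∧ ∃ x ∈ Icc (0 : ℝ) 1, ∃ y ∈ Icc (0 : ℝ) 1,
      wordSlope n v x = s ∧ wordSlope n v y = t := by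
    intro m
    induction m with
    | zero => exact ⟨[], rfl, s, hs, t, ht, rfl, rfl⟩
    | succ m ih =>
      obtain ⟨v, hv, x, hx, y, hy, hxs, hyt⟩ := ih
      have hxy : x < y := by
        by_contra! h
        rcases h.eq_or_lt with h | h
        · rw [← h] at hxs
          linarith
        · have := wordSlope_lt hn v hy hx h
          linarith
      rcases le_total y (1 / 2) with h | h
      · have hx' : x ∈ Icc (0 : ℝ) (1 / 2) := ⟨hx.1, hxy.le.trans h⟩
        have hy' : y ∈ Icc (0 : ℝ) (1 / 2) := ⟨hy.1, h⟩
        refine ⟨false :: v, by simp [hv], _, slopeInv_mem hn x, _, slopeInv_mem hn y, ?_, ?_⟩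
        · simp [wordSlope, slopeMap_slopeInv hn hx', hxs]
        · simp [wordSlope, slopeMap_slopeInv hn hy', hyt]
      rcases le_total x (1 / 2) with h' | h'
      · exact absurd hyt (hcon v x ⟨hx.1, h'⟩ y ⟨h, hy.2⟩ hxs)
      · have hx' : x ∈ Icc (1 / 2 : ℝ) 1 := ⟨h', hx.2⟩
        have hy' : y ∈ Icc (1 / 2 : ℝ) 1 := ⟨h, hy.2⟩
        refine ⟨true :: v, by simp [hv], _, one_sub_mem (slopeInv_mem hn (1 - x)), _,
          one_sub_mem (slopeInv_mem hn (1 - y)), ?_, ?_⟩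
        · simp [wordSlope, slopeMap_slopeInv_true hn hx', hxs]
        · simp [wordSlope, slopeMap_slopeInv_true hn hy', hyt]
  obtain ⟨m, hm⟩ := ((tendsto_cell hn).eventually (gt_mem_nhds (by linarith :
    (0 : ℝ) < t - s))).exists
  obtain ⟨v, rfl, x, hx, y, hy, hxs, hyt⟩ := key m
  have := wordSlope_sub_le_cell hn v hx hy
  linarith

variable {P : ℝ → ℝ × ℝ}

/-! ### Slope against abscissa -/

/-- The abscissa of the point of slope `u`, measured along `p_2 - p_1` and normalized so that it
runs from `-1` to `1`. -/
def abscissa (P : ℝ → ℝ × ℝ) (u : ℝ) : ℝ := (P u).1 + (P u).2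

lemma wordS_sub (v : List Bool) (y z : ℝ × ℝ) :
    wordS n v y - wordS n v z = wordT n v (y - z) := by
  induction v generalizing y z with
  | nil => rfl
  | cons b v ih =>
    simp only [wordS, wordT, Function.comp_apply, LinearMap.comp_apply]
    rw [ih, planeS_sub]

namespace IsSlopeParam

lemma map_wordSlope (hn : 2 ≤ n) (hP : IsSlopeParam n P) (v : List Bool) {u : ℝ}
    (hu : u ∈ Icc (0 : ℝ) 1) : P (wordSlope n v u) = wordS n v (P u) := by
  induction v generalizing u with
  | nil => rfl
  | cons b v ih =>
    simp only [wordS, wordSlope, Function.comp_apply]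
    rw [ih (slopeMap_mem hn b hu), hP.map_slopeMap b u hu]

/-- The symmetry of the curve exchanging its end points. -/
lemma reflect (hn : 2 ≤ n) (hP : IsSlopeParam n P) :
    IsSlopeParam n fun u => -(P (1 - u)).swap where
  continuous := (continuous_swap.comp (hP.continuous.comp (by fun_prop))).neg
  map_zero := by simp [hP.map_one]
  map_one := by simp [hP.map_zero]
  chord s hs t ht hst := by
    have h := hP.chord _ (one_sub_mem ht) _ (one_sub_mem hs) (by linarith)
    obtain ⟨h1, h2, h3, h4⟩ := h
    simp only [Prod.fst_sub, Prod.snd_sub] at h1 h2 h3 h4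
    refine ⟨?_, ?_, ?_, ?_⟩ <;>
      simp only [Prod.fst_sub, Prod.snd_sub, Prod.fst_neg, Prod.snd_neg, Prod.fst_swap,
        Prod.snd_swap] <;> linarith
  map_slopeMap b u hu := by
    have h3 : n + 2 ≠ 0 := by linarith
    cases b
    · have h := slopeMap_true_eq hn (one_sub_mem hu)
      rw [sub_sub_cancel] at h
      simp only [← h, hP.map_slopeMap true _ (one_sub_mem hu)]
      ext <;> simp [planeS] <;> ring
    · rw [slopeMap_true_eq hn hu]
      simp only [sub_sub_cancel, hP.map_slopeMap false _ (one_sub_mem hu)]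
      ext <;> simp [planeS] <;> ring

lemma abscissa_zero (hP : IsSlopeParam n P) : abscissa P 0 = -1 := by
  simp [abscissa, hP.map_zero]

lemma abscissa_one (hP : IsSlopeParam n P) : abscissa P 1 = 1 := by
  simp [abscissa, hP.map_one]

lemma map_half (hP : IsSlopeParam n P) : P (1 / 2) = planeS n true (planeV false) := by
  rw [← hP.map_zero, ← hP.map_slopeMap true 0 ⟨le_rfl, zero_le_one⟩, slopeMap_true_zero]

lemma abscissa_half (hn : 2 ≤ n) (hP : IsSlopeParam n P) : abscissa P (1 / 2) = 0 := by
  have h3 : n + 2 ≠ 0 := by linarith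
  simp only [abscissa, hP.map_half, planeS, planeT_true, planeV_true, planeV_false]
  simp
  field_simp
  ring

lemma abscissa_mono (hP : IsSlopeParam n P) {s t : ℝ} (hs : s ∈ Icc (0 : ℝ) 1)
    (ht : t ∈ Icc (0 : ℝ) 1) (hst : s ≤ t) : abscissa P s ≤ abscissa P t := by
  have h := hP.chord s hs t ht hst
  have h1 := h.fst_nonneg
  have h2 := h.snd_nonneg
  simp only [Prod.fst_sub, Prod.snd_sub] at h1 h2
  simp only [abscissa]
  linarith

/-- The chord condition, in terms of the abscissa and the second coordinate. -/
lemma snd_sub_mem (hP : IsSlopeParam n P) {s t : ℝ} (hs : s ∈ Icc (0 : ℝ) 1)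
    (ht : t ∈ Icc (0 : ℝ) 1) (hst : s ≤ t) :
    (P t).2 - (P s).2 ∈ Icc (s * (abscissa P t - abscissa P s))
      (t * (abscissa P t - abscissa P s)) := by
  have h := hP.chord s hs t ht hst
  have h1 := h.left
  have h2 := h.right
  simp only [Prod.fst_sub, Prod.snd_sub] at h1 h2
  simp only [abscissa]
  constructor <;> linarith

lemma abscissa_slopeMap_false (hn : 2 ≤ n) (hP : IsSlopeParam n P) {u : ℝ}
    (hu : u ∈ Icc (0 : ℝ) 1) :
    abscissa P (slopeMap n false u) + 1 =
      (n * (abscissa P u + 1) - (n - 2) * (P u).2) / (n + 2) := by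
  have h3 : n + 2 ≠ 0 := by linarith
  simp only [abscissa, hP.map_slopeMap false u hu, planeS, planeT_false, planeV_false]
  simp
  field_simp
  ring

lemma le_abscissa_slopeMap_false (hn : 2 ≤ n) (hP : IsSlopeParam n P) {u : ℝ}
    (hu : u ∈ Icc (0 : ℝ) 1) :
    (n * (1 - u) + 2 * u) * (abscissa P u + 1) / (n + 2) ≤
      abscissa P (slopeMap n false u) + 1 := by
  rw [hP.abscissa_slopeMap_false hn hu]
  refine div_le_div_of_nonneg_right ?_ (by linarith)
  have h := (hP.snd_sub_mem ⟨le_rfl, zero_le_one⟩ hu hu.1).2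
  rw [hP.abscissa_zero, hP.map_zero] at h
  simp only [planeV_false, sub_zero, sub_neg_eq_add] at h
  nlinarith

/-- The abscissa dominates the slope near the left end point. -/
lemma le_abscissa_add_one (hn : 2 ≤ n) (hP : IsSlopeParam n P) {τ : ℝ}
    (hτ : τ ∈ Icc (0 : ℝ) 1) : τ ≤ abscissa P τ + 1 := by
  have key : ∀ k : ℕ, ∀ τ ∈ Icc (0 : ℝ) 1, τ ≤ abscissa P τ + 1 + (1 / 2) ^ k := by
    intro k
    induction k with
    | zero =>
      intro τ hτ
      have := hP.abscissa_mono ⟨le_rfl, zero_le_one⟩ hτ hτ.1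
      rw [hP.abscissa_zero] at this
      rw [pow_zero]
      linarith [hτ.2]
    | succ k ih =>
      intro τ hτ
      have hk : (0 : ℝ) < (1 / 2) ^ k := by positivity
      have hm : (1 / 2 : ℝ) ∈ Icc (0 : ℝ) 1 := by constructor <;> norm_num
      rcases le_total (1 / 2) τ with h | h
      · have := hP.abscissa_mono hm hτ h
        rw [hP.abscissa_half hn] at this
        have : (0 : ℝ) ≤ (1 / 2) ^ (k + 1) := by positivity
        linarith [hτ.2]
      obtain ⟨u, hu, rfl⟩ : ∃ u ∈ Icc (0 : ℝ) 1, slopeMap n false u = τ :=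
        ⟨_, slopeInv_mem hn τ, slopeMap_slopeInv hn ⟨hτ.1, h⟩⟩
      rcases le_total u (1 / 2) with h' | h'
      · have h1 := ih u hu
        have h2 := hP.le_abscissa_slopeMap_false hn hu
        have h3 := two_le_weight hn hu
        have h4 : (n + 2) / 2 ≤ n * (1 - u) + 2 * u := by nlinarith
        have h5 := hP.abscissa_mono ⟨le_rfl, zero_le_one⟩ hu hu.1
        rw [hP.abscissa_zero] at h5
        rw [slopeMap_false] at h2 ⊢
        generalize n * (1 - u) + 2 * u = D at *
        generalize abscissa P (u / D) = y at *
        have h6 : u / D ≤ (abscissa P u + 1) / D + (1 / 2) ^ k / D := by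
          rw [← add_div]
          exact div_le_div_of_nonneg_right h1 (by linarith)
        have h7 : (1 / 2 : ℝ) ^ k / D ≤ (1 / 2) ^ (k + 1) := by
          rw [pow_succ, mul_one_div]
          exact div_le_div_of_nonneg_left hk.le (by norm_num) h3
        have h8 : (abscissa P u + 1) / D ≤ D * (abscissa P u + 1) / (n + 2) := by
          rw [div_le_div_iff₀ (by linarith) (by linarith)]
          have : n + 2 ≤ D * D := by nlinarith
          nlinarith [mul_le_mul_of_nonneg_left this (by linarith : 0 ≤ abscissa P u + 1)]
        linarith
      · have h1 := hP.abscissa_mono (slopeMap_mem hn false hm) hτ (slopeMap_le hn false hm hu h')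
        have h2 := hP.le_abscissa_slopeMap_false hn hm
        rw [hP.abscissa_half hn] at h2
        have h3 : (n * (1 - 1 / 2) + 2 * (1 / 2)) * (0 + 1) / (n + 2) = 1 / 2 := by
          have : n + 2 ≠ 0 := by linarith
          field_simp
          ring
        have : (0 : ℝ) ≤ (1 / 2) ^ (k + 1) := by positivity
        linarith
  refine le_of_forall_pos_le_add fun ε hε => ?_
  obtain ⟨k, hk⟩ := exists_pow_lt_of_lt_one hε (by norm_num : (1 / 2 : ℝ) < 1)
  linarith [key k τ hτ]

lemma half_sub_le (hn : 2 ≤ n) (hP : IsSlopeParam n P) {τ : ℝ} (hτ : τ ∈ Icc (0 : ℝ) (1 / 2)) :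
    1 / 2 - τ ≤ n * (n + 2) / 8 * (0 - abscissa P τ) := by
  have hn2 : 0 < n + 2 := by linarith
  obtain ⟨u, hu, rfl⟩ : ∃ u ∈ Icc (0 : ℝ) 1, slopeMap n false u = τ :=
    ⟨_, slopeInv_mem hn τ, slopeMap_slopeInv hn hτ⟩
  have h1 : 1 / 2 - slopeMap n false u ≤ n / 4 * (1 - u) := by
    have h3 := two_le_weight hn hu
    rw [slopeMap_false, div_sub_div _ _ two_ne_zero (by linarith), div_le_iff₀ (by linarith)]
    nlinarith [mul_nonneg (by linarith : 0 ≤ n) (by linarith [hu.2] : 0 ≤ 1 - u)]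
  have h2 : (1 - u) ≤ 1 - abscissa P u := by
    have h := (hP.reflect hn).le_abscissa_add_one hn (one_sub_mem hu)
    simp only [abscissa, sub_sub_cancel, Prod.fst_neg, Prod.snd_neg, Prod.fst_swap,
      Prod.snd_swap] at h ⊢
    linarith
  have h3 : 2 / (n + 2) * (1 - abscissa P u) ≤ 0 - abscissa P (slopeMap n false u) := by
    have h4 := hP.abscissa_slopeMap_false hn hu
    have h5 := (hP.chord u hu 1 ⟨zero_le_one, le_rfl⟩ hu.2).fst_nonneg
    rw [hP.map_one] at h5
    simp only [planeV_true, Prod.fst_sub, zero_sub, Left.nonneg_neg_iff] at h5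
    rw [show 0 - abscissa P (slopeMap n false u) = 1 - (abscissa P (slopeMap n false u) + 1) by
      ring, h4, one_sub_div hn2.ne', div_mul_eq_mul_div]
    refine div_le_div_of_nonneg_right ?_ hn2.le
    simp only [abscissa]
    nlinarith
  calc 1 / 2 - slopeMap n false u ≤ n / 4 * (1 - u) := h1
    _ ≤ n / 4 * (1 - abscissa P u) := mul_le_mul_of_nonneg_left h2 (by linarith)
    _ = n * (n + 2) / 8 * (2 / (n + 2) * (1 - abscissa P u)) := by field_simp; ring
    _ ≤ _ := mul_le_mul_of_nonneg_left h3 (by positivity)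

/-- Slopes separated by `1 / 2` are at most as far apart as the abscissas, up to a factor. -/
lemma sub_le_of_separated (hn : 2 ≤ n) (hP : IsSlopeParam n P) {s t : ℝ}
    (hs : s ∈ Icc (0 : ℝ) (1 / 2)) (ht : t ∈ Icc (1 / 2 : ℝ) 1) :
    t - s ≤ n * (n + 2) / 8 * (abscissa P t - abscissa P s) := by
  have h1 := hP.half_sub_le hn hs
  have h2 := (hP.reflect hn).half_sub_le hn
    (⟨by linarith [ht.2], by linarith [ht.1]⟩ : 1 - t ∈ Icc (0 : ℝ) (1 / 2))
  simp only [abscissa, sub_sub_cancel, Prod.fst_neg, Prod.snd_neg, Prod.fst_swap,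
    Prod.snd_swap] at h1 h2 ⊢
  linarith

lemma abscissa_wordSlope_sub (hn : 2 ≤ n) (hP : IsSlopeParam n P) (v : List Bool) {s t : ℝ}
    (hs : s ∈ Icc (0 : ℝ) 1) (ht : t ∈ Icc (0 : ℝ) 1) (hst : s ≤ t) :
    growth n ^ v.length / (n * (n + 2) ^ v.length) * (abscissa P t - abscissa P s) ≤
      abscissa P (wordSlope n v t) - abscissa P (wordSlope n v s) := by
  have h := hP.chord s hs t ht hst
  have h1 := h.fst_nonneg
  have h2 := h.snd_nonneg
  have e : abscissa P (wordSlope n v t) - abscissa P (wordSlope n v s) =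
      (wordT n v (P t - P s)).1 + (wordT n v (P t - P s)).2 := by
    rw [← wordS_sub, ← hP.map_wordSlope hn v hs, ← hP.map_wordSlope hn v ht]
    simp only [abscissa, Prod.fst_sub, Prod.snd_sub]
    ring
  have e' : abscissa P t - abscissa P s = (P t - P s).1 + (P t - P s).2 := by
    simp only [abscissa, Prod.fst_sub, Prod.snd_sub]
    ring
  rw [e, e', wordT_add hn, ← div_div, div_mul_eq_mul_div]
  refine div_le_div_of_nonneg_right ?_ (by positivity)
  obtain ⟨k1, k2⟩ := weight_le hn v
  have k3 := pow_le_weight_add hn v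
  have hn0 : 0 < n := by linarith
  have k4 : growth n ^ v.length / n ≤ (weight n v).1 := by
    rw [div_le_iff₀ hn0]
    linarith
  have k5 : growth n ^ v.length / n ≤ (weight n v).2 := by
    rw [div_le_iff₀ hn0]
    linarith
  nlinarith [mul_le_mul_of_nonneg_left k4 h1, mul_le_mul_of_nonneg_left k5 h2]

end IsSlopeParam

/-! ### Hölder continuity of the slope -/

/-- The Hölder exponent `log (λ² / n) / log ((n + 2) / λ)` with `λ = growth n`. -/
noncomputable def exponent (n : ℝ) : ℝ :=
  Real.log (growth n ^ 2 / n) / Real.log ((n + 2) / growth n)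

lemma log_ratio_pos (hn : 2 ≤ n) : 0 < Real.log ((n + 2) / growth n) := by
  have := two_le_growth hn
  have := growth_le hn
  refine Real.log_pos ?_
  rw [one_lt_div (by linarith)]
  linarith

lemma exponent_pos (hn : 2 ≤ n) : 0 < exponent n := by
  refine div_pos (Real.log_pos ?_) (log_ratio_pos hn)
  rw [one_lt_div (by linarith), growth_sq hn]
  linarith [two_le_growth hn]

lemma exponent_le_one (hn : 2 ≤ n) : exponent n ≤ 1 := by
  have h1 := two_le_growth hn
  have h2 := growth_le hn
  have h3 := growth_sq hn
  rw [exponent, div_le_one (log_ratio_pos hn)]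
  refine Real.log_le_log (by positivity) ?_
  rw [div_le_div_iff₀ (by linarith) (by linarith), h3]
  nlinarith

/-- The exponent is chosen so that the slopes and the abscissas of the cells scale accordingly
along the periodic word `1212⋯`. -/
lemma ratio_rpow_exponent (hn : 2 ≤ n) :
    (growth n / (n + 2)) ^ exponent n = n / growth n ^ 2 := by
  have h1 := two_le_growth hn
  have h2 : 0 < n / growth n ^ 2 := by positivity
  rw [Real.rpow_def_of_pos (by positivity), ← Real.exp_log h2, exponent]
  congr 1
  rw [← inv_div (n + 2), ← inv_div (growth n ^ 2), Real.log_inv, Real.log_inv]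
  have := (log_ratio_pos hn).ne'
  field_simp

namespace IsSlopeParam

theorem sub_le_rpow (hn : 2 ≤ n) (hP : IsSlopeParam n P) :
    ∃ C : ℝ, 0 < C ∧ ∀ s ∈ Icc (0 : ℝ) 1, ∀ t ∈ Icc (0 : ℝ) 1, s ≤ t →
      t - s ≤ C * (abscissa P t - abscissa P s) ^ exponent n := by
  have hg := two_le_growth hn
  have hn0 : 0 < n := by linarith
  have hα := exponent_pos hn
  set K := n * (n * (n + 2) / 8) with hK
  have hK0 : 0 < K := by positivity
  refine ⟨n ^ 2 * K ^ exponent n, by positivity, fun s hs t ht hst => ?_⟩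
  rcases hst.eq_or_lt with rfl | hlt
  · rw [sub_self, sub_self, Real.zero_rpow hα.ne', mul_zero]
  obtain ⟨v, x, hx, y, hy, rfl, rfl⟩ := exists_separating_word hn hs ht hlt
  have hx' : x ∈ Icc (0 : ℝ) 1 := ⟨hx.1, hx.2.trans (by norm_num)⟩
  have hy' : y ∈ Icc (0 : ℝ) 1 := ⟨le_trans (by norm_num) hy.1, hy.2⟩
  have hxy : x ≤ y := hx.2.trans hy.1
  have h1 := wordSlope_sub_le hn v hx' hy' hxy
  have h2 := hP.abscissa_wordSlope_sub hn v hx' hy' hxy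
  have h3 := hP.sub_le_of_separated hn hx hy
  set X := abscissa P (wordSlope n v y) - abscissa P (wordSlope n v x)
  have hδ : 0 ≤ y - x := by linarith
  have h4 : (growth n / (n + 2)) ^ v.length * (y - x) ≤ K * X := by
    have h5 : 0 ≤ growth n ^ v.length / (n * (n + 2) ^ v.length) := by positivity
    calc (growth n / (n + 2)) ^ v.length * (y - x)
        = n * (growth n ^ v.length / (n * (n + 2) ^ v.length) * (y - x)) := by
          rw [div_pow]
          field_simp
      _ ≤ n * (growth n ^ v.length / (n * (n + 2) ^ v.length) *
          (n * (n + 2) / 8 * (abscissa P y - abscissa P x))) := by gcongr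
      _ = K * (growth n ^ v.length / (n * (n + 2) ^ v.length) *
          (abscissa P y - abscissa P x)) := by rw [hK]; ring
      _ ≤ K * X := by gcongr
  have hX : 0 ≤ X := by
    have : 0 ≤ K * X := le_trans (by positivity) h4
    exact nonneg_of_mul_nonneg_right this hK0
  have h5 : (n / growth n ^ 2) ^ v.length * (y - x) ^ exponent n ≤ K ^ exponent n *
      X ^ exponent n := by
    rw [← Real.mul_rpow hK0.le hX, ← ratio_rpow_exponent hn,
      Real.rpow_pow_comm (by positivity), ← Real.mul_rpow (by positivity) hδ]
    exact Real.rpow_le_rpow (by positivity) h4 hα.le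
  have h6 : y - x ≤ (y - x) ^ exponent n := by
    rcases hδ.eq_or_lt with h | h
    · rw [← h, Real.zero_rpow hα.ne']
    · have := Real.rpow_le_rpow_of_exponent_ge h (by linarith [hx.1, hy.2]) (exponent_le_one hn)
      rwa [Real.rpow_one] at this
  calc _ ≤ n ^ 2 * (n / growth n ^ 2) ^ v.length * (y - x) := h1
    _ ≤ n ^ 2 * (n / growth n ^ 2) ^ v.length * (y - x) ^ exponent n := by gcongr
    _ = n ^ 2 * ((n / growth n ^ 2) ^ v.length * (y - x) ^ exponent n) := by ring
    _ ≤ n ^ 2 * (K ^ exponent n * X ^ exponent n) := by gcongr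
    _ = _ := by ring

lemma abscissa_injOn (hn : 2 ≤ n) (hP : IsSlopeParam n P) :
    InjOn (abscissa P) (Icc 0 1) := by
  obtain ⟨C, -, h⟩ := hP.sub_le_rpow hn
  have key : ∀ s ∈ Icc (0 : ℝ) 1, ∀ t ∈ Icc (0 : ℝ) 1, abscissa P s = abscissa P t → t ≤ s := by
    intro s hs t ht hst
    rcases le_total t s with h' | h'
    · exact h'
    · have := h s hs t ht h'
      rw [hst, sub_self, Real.zero_rpow (exponent_pos hn).ne', mul_zero] at this
      linarith
  exact fun s hs t ht hst => le_antisymm (key t ht s hs hst.symm) (key s hs t ht hst)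

/-! ### The slope as a function of the abscissa -/

/-- The slope is a Hölder continuous function `τ` of the normalized abscissa `t ∈ [0, 1]`, and it
is the derivative of the second coordinate (up to the factor `2`). -/
theorem exists_slope (hn : 2 ≤ n) (hP : IsSlopeParam n P) :
    ∃ τ : ℝ → ℝ, (∀ t ∈ Icc (0 : ℝ) 1, τ t ∈ Icc (0 : ℝ) 1) ∧
      (∀ t ∈ Icc (0 : ℝ) 1, abscissa P (τ t) = 2 * t - 1) ∧
      (∃ C : ℝ, 0 < C ∧ ∀ s ∈ Icc (0 : ℝ) 1, ∀ t ∈ Icc (0 : ℝ) 1,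
        |τ t - τ s| ≤ C * |t - s| ^ exponent n) ∧
      ∀ t ∈ Icc (0 : ℝ) 1, HasDerivWithinAt (fun t => (P (τ t)).2) (2 * τ t) (Icc 0 1) t := by
  have hcont : Continuous (abscissa P) :=
    (continuous_fst.comp hP.continuous).add (continuous_snd.comp hP.continuous)
  have hex : ∀ t : ℝ, ∃ u, t ∈ Icc (0 : ℝ) 1 → u ∈ Icc (0 : ℝ) 1 ∧ abscissa P u = 2 * t - 1 := by
    intro t
    by_cases ht : t ∈ Icc (0 : ℝ) 1
    · have := intermediate_value_Icc (zero_le_one (α := ℝ)) hcont.continuousOn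
      obtain ⟨u, hu, h⟩ := this (show 2 * t - 1 ∈ Icc (abscissa P 0) (abscissa P 1) by
        rw [hP.abscissa_zero, hP.abscissa_one]
        constructor <;> linarith [ht.1, ht.2])
      exact ⟨u, fun _ => ⟨hu, h⟩⟩
    · exact ⟨0, fun h => absurd h ht⟩
  choose τ hτ using hex
  obtain ⟨C, hC, hC'⟩ := hP.sub_le_rpow hn
  have habs : ∀ s ∈ Icc (0 : ℝ) 1, ∀ t ∈ Icc (0 : ℝ) 1,
      |τ t - τ s| ≤ C * 2 ^ exponent n * |t - s| ^ exponent n := by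
    have one : ∀ s ∈ Icc (0 : ℝ) 1, ∀ t ∈ Icc (0 : ℝ) 1, τ s ≤ τ t →
        |τ t - τ s| ≤ C * 2 ^ exponent n * |t - s| ^ exponent n := by
      intro s hs t ht hst
      have h1 := hC' _ (hτ s hs).1 _ (hτ t ht).1 hst
      have h2 := hP.abscissa_mono (hτ s hs).1 (hτ t ht).1 hst
      rw [(hτ s hs).2, (hτ t ht).2] at h1 h2
      rw [abs_of_nonneg (by linarith), mul_assoc, ← Real.mul_rpow (by norm_num) (abs_nonneg _),
        abs_of_nonneg (by linarith : 0 ≤ t - s), show 2 * (t - s) = 2 * t - 1 - (2 * s - 1) by ring]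
      exact h1
    intro s hs t ht
    rcases le_total (τ s) (τ t) with h | h
    · exact one s hs t ht h
    · rw [abs_sub_comm, abs_sub_comm t]
      exact one t ht s hs h
  refine ⟨τ, fun t ht => (hτ t ht).1, fun t ht => (hτ t ht).2,
    ⟨C * 2 ^ exponent n, by positivity, habs⟩, fun t ht => ?_⟩
  have hbound : ∀ s ∈ Icc (0 : ℝ) 1,
      |(P (τ s)).2 - (P (τ t)).2 - (s - t) * (2 * τ t)| ≤ 2 * |τ s - τ t| * |s - t| := by
    intro s hs
    rcases le_total (τ t) (τ s) with h | h
    · have h1 := hP.snd_sub_mem (hτ t ht).1 (hτ s hs).1 h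
      have h2 := hP.abscissa_mono (hτ t ht).1 (hτ s hs).1 h
      rw [(hτ s hs).2, (hτ t ht).2] at h1 h2
      obtain ⟨h1, h3⟩ := h1
      rw [abs_of_nonneg (sub_nonneg.2 h), abs_of_nonneg (by linarith : 0 ≤ s - t), abs_le]
      constructor <;> nlinarith [mul_nonneg (sub_nonneg.2 h) (by linarith : 0 ≤ s - t)]
    · have h1 := hP.snd_sub_mem (hτ s hs).1 (hτ t ht).1 h
      have h2 := hP.abscissa_mono (hτ s hs).1 (hτ t ht).1 h
      rw [(hτ s hs).2, (hτ t ht).2] at h1 h2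
      obtain ⟨h1, h3⟩ := h1
      rw [abs_of_nonpos (sub_nonpos.2 h), abs_of_nonpos (by linarith : s - t ≤ 0), abs_le]
      constructor <;> nlinarith [mul_nonneg (sub_nonneg.2 h) (by linarith : 0 ≤ t - s)]
  rw [hasDerivWithinAt_iff_isLittleO, Asymptotics.isLittleO_iff]
  intro ε hε
  have hlim : Tendsto (fun s => 2 * (C * 2 ^ exponent n * |s - t| ^ exponent n))
      (𝓝[Icc 0 1] t) (𝓝 0) := by
    have : Continuous fun s => 2 * (C * 2 ^ exponent n * |s - t| ^ exponent n) := by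
      refine continuous_const.mul (continuous_const.mul ?_)
      exact (continuous_id.sub continuous_const).abs.rpow_const
        fun _ => Or.inr (exponent_pos hn).le
    have h := this.tendsto t
    simp only [sub_self, abs_zero, Real.zero_rpow (exponent_pos hn).ne', mul_zero] at h
    exact h.mono_left nhdsWithin_le_nhds
  filter_upwards [hlim.eventually (gt_mem_nhds hε), self_mem_nhdsWithin] with s hs1 hs
  have h1 := hbound s hs
  have h2 := habs t ht s hs
  rw [smul_eq_mul, Real.norm_eq_abs, Real.norm_eq_abs]
  exact h1.trans (mul_le_mul_of_nonneg_right (by linarith) (abs_nonneg _))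

/-! ### The slope has no positive lower derivative on any cell -/

/-- Near the left end point the slope is small compared with the abscissa, if `n > 2`. -/
lemma exists_lt_abscissa (hn : 2 < n) (hP : IsSlopeParam n P) {c : ℝ} (hc : 0 < c) :
    ∃ u ∈ Icc (0 : ℝ) 1, 0 < u ∧ u < c * (abscissa P u + 1) := by
  have key : ∀ k : ℕ, ∃ u ∈ Icc (0 : ℝ) (1 / 2), 0 < u ∧
      u ≤ (4 / (n + 2)) ^ k * (abscissa P u + 1) := by
    intro k
    induction k with
    | zero =>
      refine ⟨1 / 2, ⟨by norm_num, le_rfl⟩, by norm_num, ?_⟩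
      rw [hP.abscissa_half hn.le]
      norm_num
    | succ k ih =>
      obtain ⟨u, hu, hu0, h⟩ := ih
      have hu' : u ∈ Icc (0 : ℝ) 1 := ⟨hu.1, hu.2.trans (by norm_num)⟩
      refine ⟨slopeMap n false u, slopeMap_false_mem hn.le hu', ?_, ?_⟩
      · rw [slopeMap_false]
        exact div_pos hu0 (by linarith [two_le_weight hn.le hu'])
      · have h1 := hP.le_abscissa_slopeMap_false hn.le hu'
        have h2 : (n + 2) / 2 ≤ n * (1 - u) + 2 * u := by nlinarith [hu.2]
        have h3 : 0 < abscissa P u + 1 := hu0.trans_le (hP.le_abscissa_add_one hn.le hu')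
        set q := (4 / (n + 2)) ^ k with hq
        have hq0 : 0 < q := by positivity
        refine le_trans ?_ (mul_le_mul_of_nonneg_left h1 (by positivity))
        rw [slopeMap_false, pow_succ, ← hq]
        generalize n * (1 - u) + 2 * u = D at *
        have hD : 0 < D := by linarith
        have hD2 : (n + 2) ^ 2 ≤ 4 * D ^ 2 := by nlinarith
        rw [div_le_iff₀ hD]
        refine h.trans ?_
        rw [show q * (4 / (n + 2)) * (D * (abscissa P u + 1) / (n + 2)) * D =
          q * (abscissa P u + 1) * (4 * D ^ 2 / (n + 2) ^ 2) by field_simp]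
        refine le_mul_of_one_le_right (by positivity) ?_
        rwa [one_le_div (by positivity)]
  obtain ⟨k, hk⟩ := exists_pow_lt_of_lt_one hc (by
    rw [div_lt_one (by linarith)]; linarith : 4 / (n + 2) < 1)
  obtain ⟨u, hu, hu0, h⟩ := key k
  have hu' : u ∈ Icc (0 : ℝ) 1 := ⟨hu.1, hu.2.trans (by norm_num)⟩
  refine ⟨u, hu', hu0, h.trans_lt ?_⟩
  exact mul_lt_mul_of_pos_right hk (hu0.trans_le (hP.le_abscissa_add_one hn.le hu'))

/-- On no interval do the slopes grow at least linearly in the abscissa, if `n > 2`. -/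
theorem not_expanding (hn : 2 < n) (hP : IsSlopeParam n P) {s t c : ℝ} (hs : s ∈ Icc (0 : ℝ) 1)
    (ht : t ∈ Icc (0 : ℝ) 1) (hst : s < t) (hc : 0 < c) :
    ∃ x ∈ Icc s t, ∃ y ∈ Icc s t, x ≤ y ∧ y - x < c * (abscissa P y - abscissa P x) := by
  obtain ⟨v, hv⟩ := exists_cell_subset hn.le hs ht hst
  have hg := two_le_growth hn.le
  set K := n ^ 2 * (n / growth n ^ 2) ^ v.length with hK
  set D := growth n ^ v.length / (n * (n + 2) ^ v.length) with hD
  have hK0 : 0 < K := by positivity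
  have hD0 : 0 < D := by positivity
  obtain ⟨u, hu, hu0, h⟩ := hP.exists_lt_abscissa hn (by positivity : 0 < c * D / K)
  have h0 : (0 : ℝ) ∈ Icc (0 : ℝ) 1 := ⟨le_rfl, zero_le_one⟩
  refine ⟨_, hv 0 h0, _, hv u hu, (wordSlope_lt hn.le v h0 hu hu0).le, ?_⟩
  have h1 := wordSlope_sub_le hn.le v h0 hu hu.1
  have h2 := hP.abscissa_wordSlope_sub hn.le v h0 hu hu.1
  rw [hP.abscissa_zero] at h2
  calc _ ≤ K * (u - 0) := h1
    _ < K * (c * D / K * (abscissa P u + 1)) := by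
      rw [sub_zero]
      exact mul_lt_mul_of_pos_left h hK0
    _ = c * (D * (abscissa P u - -1)) := by field_simp; ring
    _ ≤ _ := mul_le_mul_of_nonneg_left h2 hc.le

end IsSlopeParam

/-! ### Attractors of contractions -/

/-- A compact set covered by its images under contractions lies in every compact set that is
mapped into itself: the maximal distance to the latter contracts, so it vanishes. -/
lemma subset_of_subset_iUnion_image {ι E : Type*} [MetricSpace E] {f : ι → E → E} {c : ℝ≥0}
    (hc : c < 1) (hf : ∀ i, LipschitzWith c (f i)) {A B : Set E} (hA : IsCompact A)
    (hAf : A ⊆ ⋃ i, f i '' A) (hB : IsCompact B) (hne : B.Nonempty)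
    (hBf : ∀ i, f i '' B ⊆ B) : A ⊆ B := by
  rcases A.eq_empty_or_nonempty with rfl | hAne
  · exact empty_subset _
  obtain ⟨x, hx, hmax⟩ := hA.exists_isMaxOn hAne (Metric.continuous_infDist_pt B).continuousOn
  obtain ⟨i, y, hy, rfl⟩ := mem_iUnion.1 (hAf hx)
  obtain ⟨b, hb, hyb⟩ := hB.exists_infDist_eq_dist hne y
  have h1 : Metric.infDist (f i y) B ≤ c * Metric.infDist y B := by
    rw [hyb]
    exact (Metric.infDist_le_dist_of_mem (hBf i (mem_image_of_mem _ hb))).trans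
      ((hf i).dist_le_mul y b)
  have h2 : Metric.infDist y B ≤ Metric.infDist (f i y) B := hmax hy
  have h0 : Metric.infDist (f i y) B ≤ 0 := by
    have hc' : (c : ℝ) < 1 := hc
    have h3 := Metric.infDist_nonneg (x := y) (s := B)
    nlinarith
  intro z hz
  rw [hB.isClosed.mem_iff_infDist_zero hne]
  exact le_antisymm ((hmax hz).trans h0) Metric.infDist_nonneg

lemma IsAttractor.subset {ι E : Type*} [MetricSpace E] {f : ι → E → E} {c : ℝ≥0}
    (hc : c < 1) (hf : ∀ i, LipschitzWith c (f i)) {A B : Set E} (hA : IsAttractor f A)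
    (hB : IsAttractor f B) : A ⊆ B :=
  subset_of_subset_iUnion_image hc hf hA.isCompact hA.eq_iUnion.subset hB.isCompact hB.nonempty
    fun i => (subset_iUnion (fun i => f i '' B) i).trans hB.eq_iUnion.symm.subset

/-- The attractor is the greatest subset of `B` covered by its own images. -/
lemma exists_isAttractor {ι E : Type*} [Finite ι] [TopologicalSpace E] [T2Space E]
    {f : ι → E → E} (hf : ∀ i, Continuous (f i)) {B : Set E} (hB : IsCompact B)
    (hBf : ∀ i, f i '' B ⊆ B) {x : E} (hx : x ∈ B) {i : ι} (hxi : f i x = x) :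
    ∃ K, IsAttractor f K := by
  let F : Set E →o Set E :=
    ⟨fun A => B ∩ ⋃ i, f i '' A, fun A A' h =>
      inter_subset_inter_right _ (iUnion_mono fun i => image_mono h)⟩
  have hK : F F.gfp = F.gfp := F.map_gfp
  have hKB : F.gfp ⊆ B := by
    rw [← hK]
    exact inter_subset_left
  have hKi : F.gfp = ⋃ i, f i '' F.gfp := by
    refine hK.symm.trans (inter_eq_right.2 (iUnion_subset fun i => ?_))
    exact (image_mono hKB).trans (hBf i)
  have hclB : closure F.gfp ⊆ B := closure_minimal hKB hB.isClosed
  have hclc : IsCompact (closure F.gfp) := hB.of_isClosed_subset isClosed_closure hclB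
  have hcl : closure F.gfp ⊆ F.gfp := by
    refine F.le_gfp (subset_inter hclB (closure_minimal ?_ ?_))
    · conv_lhs => rw [hKi]
      exact iUnion_mono fun i => image_mono subset_closure
    · exact isClosed_iUnion_of_finite fun i => (hclc.image (hf i)).isClosed
  refine ⟨F.gfp, ⟨x, ?_⟩, ?_, hKi⟩
  · have : ({x} : Set E) ≤ F {x} := by
      rintro y rfl
      exact ⟨hx, mem_iUnion.2 ⟨i, y, rfl, hxi⟩⟩
    exact F.le_gfp this rfl
  · rwa [← closure_eq_iff_isClosed.2 (isClosed_of_closure_subset hcl)]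

/-! ### The maps on the hyperplane -/

variable {N : ℕ}

lemma inner_p (hN : 2 ≤ N) (i j : Fin N) :
    inner ℝ (p i) (p j) = ((if i = j then 1 else 0) - 1 / (N : ℝ)) / 2 := by
  have hN0 : (N : ℝ) ≠ 0 := by positivity
  have h2 : (√2 : ℝ) * √2 = 2 := Real.mul_self_sqrt (by norm_num)
  have h2' : (√2 : ℝ) ≠ 0 := by positivity
  rw [Submodule.coe_inner, PiLp.inner_apply]
  simp only [p, RCLike.inner_apply, conj_trivial, div_mul_div_comm, h2]
  rw [← Finset.sum_div]
  congr 1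
  simp only [sub_mul, mul_sub, Finset.sum_sub_distrib]
  simp
  field_simp
  ring

lemma norm_p_sq (hN : 2 ≤ N) (j : Fin N) : ‖p j‖ ^ 2 = (1 - 1 / (N : ℝ)) / 2 := by
  rw [← real_inner_self_eq_norm_sq, inner_p hN, if_pos rfl]

lemma T_apply (hN : 2 ≤ N) (j : Fin N) (z : Y N) :
    T j z = (1 / ((N : ℝ) + 2)) • (z + (2 * N * inner ℝ (p j) z) • p j) := by
  have hN2 : (2 : ℝ) ≤ N := by exact_mod_cast hN
  have h0 : (1 - 1 / (N : ℝ)) ≠ 0 := by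
    rw [one_sub_div (by linarith)]
    exact div_ne_zero (by linarith) (by linarith)
  have h1 : (N : ℝ) ≠ 0 := by linarith
  have h2 : (N : ℝ) - 1 ≠ 0 := by linarith
  rw [T]
  simp only [add_apply, smul_apply]
  rw [Submodule.starProjection_orthogonal_val]
  rw [Submodule.starProjection_singleton, RCLike.ofReal_real_eq_id, id, norm_p_sq hN]
  rw [smul_sub, smul_add, smul_smul, smul_smul, smul_smul]
  have : (N : ℝ) / (N + 2) * (inner ℝ (p j) z / ((1 - 1 / (N : ℝ)) / 2)) =
      1 / ((N : ℝ) + 2) * (2 * N * inner ℝ (p j) z) +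
      1 / ((N : ℝ) + 2) * (inner ℝ (p j) z / ((1 - 1 / (N : ℝ)) / 2)) := by
    rw [one_sub_div h1]
    field_simp
    ring
  rw [this, add_smul]
  abel

lemma norm_T_le (hN : 2 ≤ N) (j : Fin N) (z : Y N) : ‖T j z‖ ≤ N / (N + 2) * ‖z‖ := by
  have hN2 : (2 : ℝ) ≤ N := by exact_mod_cast hN
  have h1 : |inner ℝ (p j) z| ≤ ‖p j‖ * ‖z‖ := abs_real_inner_le_norm _ _
  have h2 : 2 * (N : ℝ) * ‖p j‖ ^ 2 = N - 1 := by
    rw [norm_p_sq hN]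
    field_simp
  rw [T_apply hN, norm_smul, Real.norm_of_nonneg (by positivity), div_mul_eq_mul_div,
    div_mul_eq_mul_div, one_mul]
  refine div_le_div_of_nonneg_right ?_ (by positivity)
  calc ‖z + (2 * N * inner ℝ (p j) z) • p j‖ ≤ ‖z‖ + ‖(2 * N * inner ℝ (p j) z) • p j‖ :=
        norm_add_le _ _
    _ = ‖z‖ + 2 * N * |inner ℝ (p j) z| * ‖p j‖ := by
        rw [norm_smul, Real.norm_eq_abs, abs_mul, abs_of_nonneg (by positivity : (0 : ℝ) ≤ 2 * N)]
    _ ≤ ‖z‖ + 2 * N * (‖p j‖ * ‖z‖) * ‖p j‖ := by gcongr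
    _ = ‖z‖ + 2 * N * ‖p j‖ ^ 2 * ‖z‖ := by ring
    _ = N * ‖z‖ := by rw [h2]; ring

lemma lipschitzWith_S (hN : 2 ≤ N) (j : Fin N) :
    LipschitzWith (Real.toNNReal (N / (N + 2))) (S j) := by
  refine LipschitzWith.of_dist_le_mul fun y z => ?_
  rw [dist_eq_norm, dist_eq_norm, Real.coe_toNNReal _ (by positivity)]
  simp only [S, add_sub_add_right_eq_sub, ← map_sub, sub_sub_sub_cancel_right]
  exact norm_T_le hN j _

lemma ratio_S_lt_one : Real.toNNReal ((N : ℝ) / (N + 2)) < 1 := by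
  rw [Real.toNNReal_lt_one, div_lt_one (by positivity)]
  linarith

lemma S_p (j : Fin N) : S j (p j) = p j := by simp [S]

lemma norm_p_le (hN : 2 ≤ N) (j : Fin N) : ‖p j‖ ≤ 1 := by
  have h := norm_p_sq hN j
  have : 0 ≤ 1 / (N : ℝ) := by positivity
  nlinarith [norm_nonneg (p j)]

lemma exists_gasket (hN : 2 ≤ N) :
    ∃ X : Set (Y N), IsAttractor (fun j : Fin N => S j) X := by
  have hball : ∀ j : Fin N, S j '' Metric.closedBall 0 (N + 2) ⊆ Metric.closedBall 0 (N + 2) := by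
    rintro j _ ⟨x, hx, rfl⟩
    rw [mem_closedBall_zero_iff] at hx ⊢
    have h1 := norm_p_le hN j
    have h2 : ‖x - p j‖ ≤ N + 3 := (norm_sub_le _ _).trans (by linarith)
    calc ‖S j x‖ ≤ ‖T j (x - p j)‖ + ‖p j‖ := norm_add_le _ _
      _ ≤ N / (N + 2) * (N + 3) + 1 :=
        add_le_add ((norm_T_le hN j _).trans (mul_le_mul_of_nonneg_left h2 (by positivity))) h1
      _ ≤ N + 2 := by
        rw [div_mul_eq_mul_div, div_add_one (by positivity), div_le_iff₀ (by positivity)]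
        nlinarith
  have h1 := norm_p_le hN ⟨0, by omega⟩
  refine exists_isAttractor (fun j => (lipschitzWith_S hN j).continuous)
    (isCompact_closedBall (0 : Y N) (N + 2)) hball (x := p ⟨0, by omega⟩) ?_ (S_p _)
  rw [mem_closedBall_zero_iff]
  linarith [(Nat.cast_nonneg N : (0 : ℝ) ≤ N)]

/-! ### The plane of the curve -/

/-- The embedding of the coordinate plane, with the sign convention of `planeT`. -/
noncomputable def emb (i₁ i₂ : Fin N) : (ℝ × ℝ) →ₗ[ℝ] Y N :=
  (LinearMap.snd ℝ ℝ ℝ).smulRight (p i₂) - (LinearMap.fst ℝ ℝ ℝ).smulRight (p i₁)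

/-- The index of the map named by a letter. -/
def letter (i₁ i₂ : Fin N) (b : Bool) : Fin N := bif b then i₂ else i₁

lemma emb_apply (i₁ i₂ : Fin N) (z : ℝ × ℝ) :
    emb i₁ i₂ z = z.2 • p i₂ - z.1 • p i₁ := rfl

variable {i₁ i₂ : Fin N}

lemma T_p_self (hN : 2 ≤ N) (j : Fin N) : T j (p j) = ((N : ℝ) / (N + 2)) • p j := by
  have hN0 : (N : ℝ) ≠ 0 := by positivity
  rw [T_apply hN, inner_p hN, if_pos rfl]
  nth_rewrite 1 [← one_smul ℝ (p j)]
  rw [← add_smul, smul_smul]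
  congr 1
  field_simp
  ring

lemma T_p_of_ne (hN : 2 ≤ N) {i j : Fin N} (h : j ≠ i) :
    T j (p i) = (1 / ((N : ℝ) + 2)) • (p i - p j) := by
  have hN0 : (N : ℝ) ≠ 0 := by positivity
  rw [T_apply hN, inner_p hN, if_neg h, show 2 * (N : ℝ) * ((0 - 1 / N) / 2) = -1 by
    field_simp; ring, neg_one_smul, sub_eq_add_neg]

lemma T_emb (hN : 2 ≤ N) (h12 : i₁ ≠ i₂) (b : Bool) (z : ℝ × ℝ) :
    T (letter i₁ i₂ b) (emb i₁ i₂ z) = emb i₁ i₂ (planeT N b z) := by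
  cases b
  · simp only [letter, cond_false, emb_apply, map_sub, map_smul, T_p_self hN, T_p_of_ne hN h12,
      planeT_false]
    module
  · simp only [letter, cond_true, emb_apply, map_sub, map_smul, T_p_self hN,
      T_p_of_ne hN h12.symm, planeT_true]
    module

lemma emb_planeV (b : Bool) : emb i₁ i₂ (planeV b) = p (letter i₁ i₂ b) := by
  cases b <;> simp [letter, emb_apply]

lemma S_emb (hN : 2 ≤ N) (h12 : i₁ ≠ i₂) (b : Bool) (z : ℝ × ℝ) :
    S (letter i₁ i₂ b) (emb i₁ i₂ z) = emb i₁ i₂ (planeS N b z) := by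
  rw [S, planeS, map_add, ← T_emb hN h12, map_sub (emb i₁ i₂), emb_planeV]

lemma Tword_append (v : List (Fin N)) (j : Fin N) : Tword (v ++ [j]) = (Tword v).comp (T j) := by
  induction v with
  | nil => ext; simp [Tword]
  | cons i v ih => rw [List.cons_append, Tword, ih, Tword, ContinuousLinearMap.comp_assoc]

lemma Sword_append (v : List (Fin N)) (j : Fin N) : Sword (v ++ [j]) = Sword v ∘ S j := by
  induction v with
  | nil => rfl
  | cons i v ih => rw [List.cons_append, Sword, ih, Sword, Function.comp_assoc]

/-- The word in `Fin N` denoted by a list of letters, last letter first. -/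
def toWord (i₁ i₂ : Fin N) (v : List Bool) : List (Fin N) := v.reverse.map (letter i₁ i₂)

lemma toWord_cons (b : Bool) (v : List Bool) :
    toWord i₁ i₂ (b :: v) = toWord i₁ i₂ v ++ [letter i₁ i₂ b] := by simp [toWord]

lemma Tword_emb (hN : 2 ≤ N) (h12 : i₁ ≠ i₂) (v : List Bool) (z : ℝ × ℝ) :
    Tword (toWord i₁ i₂ v) (emb i₁ i₂ z) = emb i₁ i₂ (wordT N v z) := by
  induction v generalizing z with
  | nil => rfl
  | cons b v ih =>
    rw [toWord_cons, Tword_append, ContinuousLinearMap.comp_apply, T_emb hN h12, ih]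
    rfl

lemma Sword_emb (hN : 2 ≤ N) (h12 : i₁ ≠ i₂) (v : List Bool) (z : ℝ × ℝ) :
    Sword (toWord i₁ i₂ v) (emb i₁ i₂ z) = emb i₁ i₂ (wordS N v z) := by
  induction v generalizing z with
  | nil => rfl
  | cons b v ih =>
    rw [toWord_cons, Sword_append, Function.comp_apply, S_emb hN h12, ih]
    rfl

/-- On the orthogonal complement of the plane, each `T` is the homothety of ratio `1 / (N + 2)`. -/
lemma Tword_of_orthogonal (hN : 2 ≤ N) {z : Y N} (h1 : inner ℝ (p i₁) z = 0)
    (h2 : inner ℝ (p i₂) z = 0) (v : List Bool) :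
    Tword (toWord i₁ i₂ v) z = (1 / ((N : ℝ) + 2)) ^ v.length • z := by
  induction v with
  | nil => simp [toWord, Tword]
  | cons b v ih =>
    have : inner ℝ (p (letter i₁ i₂ b)) z = 0 := by cases b <;> assumption
    rw [toWord_cons, Tword_append, ContinuousLinearMap.comp_apply, T_apply hN, this]
    simp only [mul_zero, zero_smul, add_zero, map_smul, ih, smul_smul, List.length_cons]
    rw [pow_succ, mul_comm]

lemma lipschitzWith_Sword (hN : 2 ≤ N) (v : List (Fin N)) :
    LipschitzWith (Real.toNNReal (N / (N + 2)) ^ v.length) (Sword v) := by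
  induction v with
  | nil => simpa [Sword] using LipschitzWith.id
  | cons j v ih =>
    rw [List.length_cons, pow_succ']
    exact (lipschitzWith_S hN j).comp ih

/-! ### Kusuoka's operators and the Hilbert-Schmidt norm -/

lemma inner_smul_right_Y (c : ℝ) (x y : Y N) : inner ℝ x (c • y) = c * inner ℝ x y :=
  real_inner_smul_right x y c

lemma inner_smul_left_Y (c : ℝ) (x y : Y N) : inner ℝ (c • x) y = c * inner ℝ x y :=
  real_inner_smul_left x y c

lemma hsNormSq_eq (A : Y N →L[ℝ] Y N) :
    hsNormSq A = ∑ k, ‖A (stdOrthonormalBasis ℝ (Y N) k)‖ ^ 2 := by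
  rw [hsNormSq, Finset.sum_comm]
  exact Finset.sum_congr rfl fun k _ =>
    (stdOrthonormalBasis ℝ (Y N)).sum_sq_inner_right _

lemma hsNormSq_nonneg (A : Y N →L[ℝ] Y N) : 0 ≤ hsNormSq A := by
  rw [hsNormSq_eq]
  positivity

lemma norm_adjoint_sq (A : Y N →L[ℝ] Y N) (y : Y N) :
    ‖ContinuousLinearMap.adjoint A y‖ ^ 2 =
      ∑ k, (inner ℝ y (A (stdOrthonormalBasis ℝ (Y N) k))) ^ 2 := by
  rw [← (stdOrthonormalBasis ℝ (Y N)).sum_sq_inner_left]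
  simp only [ContinuousLinearMap.adjoint_inner_left]

lemma norm_adjoint_apply_le (A : Y N →L[ℝ] Y N) (y : Y N) :
    ‖ContinuousLinearMap.adjoint A y‖ ≤ √(hsNormSq A) * ‖y‖ := by
  refine le_of_sq_le_sq ?_ (by positivity)
  rw [mul_pow, Real.sq_sqrt (hsNormSq_nonneg A), norm_adjoint_sq, hsNormSq_eq, Finset.sum_mul]
  refine Finset.sum_le_sum fun k _ => ?_
  rw [← mul_pow, mul_comm, ← sq_abs]
  exact pow_le_pow_left₀ (abs_nonneg _) (abs_real_inner_le_norm _ _) 2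

lemma norm_apply_le (A : Y N →L[ℝ] Y N) (y : Y N) : ‖A y‖ ≤ √(hsNormSq A) * ‖y‖ := by
  refine A.le_of_opNorm_le ?_ y
  rw [← LinearIsometryEquiv.norm_map ContinuousLinearMap.adjoint A]
  exact ContinuousLinearMap.opNorm_le_bound _ (Real.sqrt_nonneg _) (norm_adjoint_apply_le A)

/-- The part of the Hilbert-Schmidt norm outside of the line spanned by the unit vector `d`. -/
lemma hsNormSq_sub_proj (A : Y N →L[ℝ] Y N) {d : Y N} (hd : ‖d‖ = 1) :
    hsNormSq (A - (Submodule.span ℝ {d}).starProjection.comp A) =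
      hsNormSq A - ‖ContinuousLinearMap.adjoint A d‖ ^ 2 := by
  rw [hsNormSq_eq, hsNormSq_eq, norm_adjoint_sq, ← Finset.sum_sub_distrib]
  refine Finset.sum_congr rfl fun k _ => ?_
  rw [sub_apply, ContinuousLinearMap.comp_apply, Submodule.starProjection_unit_singleton ℝ hd,
    norm_sub_sq_real, inner_smul_right, real_inner_comm, norm_smul, hd, mul_one,
    Real.norm_eq_abs, sq_abs]
  ring

/-- `A Aᵗ / ‖A‖²` is close to the projection onto `d` as soon as the part of `A` outside of the
line spanned by `d` is small. -/
lemma norm_normalized_sub_proj_le (A : Y N →L[ℝ] Y N) {d : Y N} (hd : ‖d‖ = 1)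
    (hA : 0 < hsNormSq A) {r : ℝ}
    (hr : r = hsNormSq (A - (Submodule.span ℝ {d}).starProjection.comp A) / hsNormSq A) :
    ‖(hsNormSq A)⁻¹ • A.comp (ContinuousLinearMap.adjoint A) -
      (Submodule.span ℝ {d}).starProjection‖ ≤ 2 * √r + r := by
  set E := A - (Submodule.span ℝ {d}).starProjection.comp A with hE
  set B := ContinuousLinearMap.adjoint A with hB
  set h := hsNormSq A with hh
  have hE0 := hsNormSq_nonneg E
  have hEz : ∀ z, E z = A z - inner ℝ d (A z) • d := fun z => by
    rw [hE, sub_apply, ContinuousLinearMap.comp_apply,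
      Submodule.starProjection_unit_singleton ℝ hd]
  have hEB : ∀ y, ‖E (B y)‖ ≤ √(hsNormSq E) * (√h * ‖y‖) := fun y =>
    (norm_apply_le E _).trans
      (mul_le_mul_of_nonneg_left (norm_adjoint_apply_le A y) (Real.sqrt_nonneg _))
  have hsq : h⁻¹ * (√(hsNormSq E) * √h) = √r := by
    rw [hr, Real.sqrt_div hE0]
    have := Real.sq_sqrt hA.le
    have h0 : √h ≠ 0 := (Real.sqrt_pos.2 hA).ne'
    field_simp
    rw [this, mul_comm]
  have hr0 : 0 ≤ r := by
    rw [hr]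
    positivity
  refine ContinuousLinearMap.opNorm_le_bound _ (by positivity) fun y => ?_
  have key : (h⁻¹ • A.comp B - (Submodule.span ℝ {d}).starProjection) y =
      h⁻¹ • E (B y) + (h⁻¹ * inner ℝ (E (B d)) y) • d - (r * inner ℝ d y) • d := by
    have e1 : inner ℝ d (A (B y)) = inner ℝ (A (B d)) y :=
      (A.adjoint_inner_left (B y) d).symm.trans (A.adjoint_inner_right (B d) y)
    have e2 : inner ℝ d (A (B d)) = ‖B d‖ ^ 2 :=
      (A.adjoint_inner_left (B d) d).symm.trans (real_inner_self_eq_norm_sq _)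
    have e3 : r = 1 - h⁻¹ * ‖B d‖ ^ 2 := by
      rw [hr, hE, hsNormSq_sub_proj A hd, ← hh, ← hB]
      field_simp
    rw [sub_apply, smul_apply, ContinuousLinearMap.comp_apply,
      Submodule.starProjection_unit_singleton ℝ hd, hEz, hEz, e1, inner_sub_left,
      inner_smul_left_Y, e2, e3]
    module
  rw [key]
  have b1 : ‖h⁻¹ • E (B y)‖ ≤ √r * ‖y‖ := by
    rw [norm_smul, Real.norm_of_nonneg (inv_nonneg.2 hA.le), ← hsq]
    calc _ ≤ h⁻¹ * (√(hsNormSq E) * (√h * ‖y‖)) :=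
          mul_le_mul_of_nonneg_left (hEB y) (inv_nonneg.2 hA.le)
      _ = _ := by ring
  have b2 : ‖(h⁻¹ * inner ℝ (E (B d)) y) • d‖ ≤ √r * ‖y‖ := by
    rw [norm_smul, hd, mul_one, Real.norm_eq_abs, abs_mul, abs_of_nonneg (inv_nonneg.2 hA.le),
      ← hsq]
    have := hEB d
    rw [hd, mul_one] at this
    calc _ ≤ h⁻¹ * (‖E (B d)‖ * ‖y‖) :=
          mul_le_mul_of_nonneg_left (abs_real_inner_le_norm _ _) (inv_nonneg.2 hA.le)
      _ ≤ h⁻¹ * (√(hsNormSq E) * √h * ‖y‖) := by gcongr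
      _ = _ := by ring
  have b3 : ‖(r * inner ℝ d y) • d‖ ≤ r * ‖y‖ := by
    rw [norm_smul, hd, mul_one, Real.norm_eq_abs, abs_mul, abs_of_nonneg hr0]
    have := abs_real_inner_le_norm d y
    rw [hd, one_mul] at this
    exact mul_le_mul_of_nonneg_left this hr0
  calc _ ≤ ‖h⁻¹ • E (B y)‖ + ‖(h⁻¹ * inner ℝ (E (B d)) y) • d‖ + ‖(r * inner ℝ d y) • d‖ :=
        (norm_sub_le _ _).trans (add_le_add_left (norm_add_le _ _) _)
    _ ≤ √r * ‖y‖ + √r * ‖y‖ + r * ‖y‖ := by gcongr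
    _ = (2 * √r + r) * ‖y‖ := by ring

/-- If the images of all vectors under `A m`, relative to the norm of `A m`, concentrate on a line,
then `A Aᵗ / ‖A‖²` converges to the projection onto that line. -/
lemma tendsto_normalized {A : ℕ → Y N →L[ℝ] Y N} {d : Y N} (hd : d ≠ 0)
    (hA : ∀ m, 0 < hsNormSq (A m))
    (h : ∀ z, Tendsto (fun m => ‖A m z - (Submodule.span ℝ {d}).starProjection (A m z)‖ ^ 2 /
      hsNormSq (A m)) atTop (𝓝 0)) :
    Tendsto (fun m => (hsNormSq (A m))⁻¹ • (A m).comp (ContinuousLinearMap.adjoint (A m))) atTop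
      (𝓝 (Submodule.span ℝ {d}).starProjection) := by
  have hd0 : ‖d‖ ≠ 0 := norm_ne_zero_iff.2 hd
  obtain ⟨e, he, hed⟩ : ∃ e : Y N, ‖e‖ = 1 ∧ Submodule.span ℝ {d} = Submodule.span ℝ {e} :=
    ⟨‖d‖⁻¹ • d, by rw [norm_smul, norm_inv, norm_norm, inv_mul_cancel₀ hd0],
      (Submodule.span_singleton_smul_eq (IsUnit.mk0 _ (inv_ne_zero hd0)) d).symm⟩
  simp only [hed] at h ⊢
  refine (tendsto_iff_norm_sub_tendsto_zero (E := Y N →L[ℝ] Y N)).2 ?_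
  have hr : Tendsto (fun m => hsNormSq (A m - (Submodule.span ℝ {e}).starProjection.comp (A m)) /
      hsNormSq (A m)) atTop (𝓝 0) := by
    simp only [hsNormSq_eq (_ - _), Finset.sum_div]
    rw [← Finset.sum_const_zero (s := Finset.univ (α := Fin (Module.finrank ℝ (Y N))))]
    exact tendsto_finsetSum _ fun k _ => h _
  have hlim : Tendsto (fun m => 2 * √(hsNormSq (A m - (Submodule.span ℝ {e}).starProjection.comp
      (A m)) / hsNormSq (A m)) + hsNormSq (A m - (Submodule.span ℝ {e}).starProjection.comp
      (A m)) / hsNormSq (A m)) atTop (𝓝 0) := by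
    have := ((hr.sqrt).const_mul 2).add hr
    rwa [Real.sqrt_zero, mul_zero, add_zero] at this
  exact squeeze_zero (fun m => by positivity)
    (fun m => norm_normalized_sub_proj_le (A m) he (hA m) rfl) hlim

/-! ### Coordinates on the plane -/

lemma inner_chord_emb (hN : 2 ≤ N) (h12 : i₁ ≠ i₂) (z : ℝ × ℝ) :
    inner ℝ (p i₂ - p i₁) (emb i₁ i₂ z) = (z.1 + z.2) / 2 := by
  simp only [emb_apply, inner_sub_left, inner_sub_right, inner_smul_right_Y, inner_p hN, if_pos,
    if_neg h12, if_neg h12.symm]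
  ring

lemma inner_add_emb (hN : 2 ≤ N) (h12 : i₁ ≠ i₂) (z : ℝ × ℝ) :
    inner ℝ (p i₁ + p i₂) (emb i₁ i₂ z) = (z.2 - z.1) * (1 / 2 - 1 / N) := by
  simp only [emb_apply, inner_add_left, inner_sub_right, inner_smul_right_Y, inner_p hN, if_pos,
    if_neg h12, if_neg h12.symm]
  ring

lemma norm_chord_le (hN : 2 ≤ N) : ‖p i₂ - p i₁‖ ≤ 2 :=
  (norm_sub_le _ _).trans (by linarith [norm_p_le hN i₁, norm_p_le hN i₂])

lemma norm_emb_direction_sub (hN : 2 ≤ N) (s t : ℝ) :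
    ‖emb i₁ i₂ (1 - t, t) - emb i₁ i₂ (1 - s, s)‖ ≤ 2 * |t - s| := by
  have : emb i₁ i₂ (1 - t, t) - emb i₁ i₂ (1 - s, s) = (t - s) • (p i₁ + p i₂) := by
    simp only [emb_apply]
    module
  rw [this, norm_smul, Real.norm_eq_abs, mul_comm]
  exact mul_le_mul_of_nonneg_right ((norm_add_le _ _).trans
    (by linarith [norm_p_le hN i₁, norm_p_le hN i₂])) (abs_nonneg _)

/-- Every vector is the sum of a vector of the plane and of an orthogonal vector. -/
lemma exists_decomposition (i₁ i₂ : Fin N) (z : Y N) : ∃ (a b : ℝ) (y : Y N),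
    inner ℝ (p i₁) y = 0 ∧ inner ℝ (p i₂) y = 0 ∧
      z = a • emb i₁ i₂ (1, 0) + b • emb i₁ i₂ (0, 1) + y := by
  set K := Submodule.span ℝ {p i₁, p i₂} with hK
  obtain ⟨a, b, hab⟩ := Submodule.mem_span_pair.1 (K.starProjection_apply_mem z)
  have hy : z - K.starProjection z ∈ Kᗮ := K.sub_starProjection_mem_orthogonal z
  refine ⟨-a, b, z - K.starProjection z, hy _ (Submodule.subset_span (by simp)),
    hy _ (Submodule.subset_span (by simp)), ?_⟩
  rw [← hab]
  simp only [emb_apply]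
  module

/-- If the cells of slopes of the words `v m` shrink to `σ`, then Kusuoka's operators converge to
the projection onto the direction of slope `σ`. -/
theorem tendsto_Z (hN : 2 ≤ N) (h12 : i₁ ≠ i₂) {v : ℕ → List Bool} (hv : ∀ m, (v m).length = m)
    {σ : ℝ} (hσ : ∀ m, ∃ u ∈ Icc (0 : ℝ) 1, wordSlope N (v m) u = σ) :
    Tendsto (fun m => Z (toWord i₁ i₂ (v m))) atTop
      (𝓝 (Submodule.span ℝ {emb i₁ i₂ (1 - σ, σ)}).starProjection) := by
  have hn : (2 : ℝ) ≤ N := by exact_mod_cast hN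
  have hg := two_le_growth hn
  set n : ℝ := (N : ℝ) with hn_def
  set W : ℕ → ℝ := fun m => ((weight n (v m)).1 + (weight n (v m)).2) / (n + 2) ^ m with hW
  have hWg : ∀ m, (growth n / (n + 2)) ^ m ≤ W m := fun m => by
    rw [div_pow]
    have := pow_le_weight_add hn (v m)
    rw [hv] at this
    exact div_le_div_of_nonneg_right this (by positivity)
  have hW0 : ∀ m, 0 < W m := fun m => lt_of_lt_of_le (by positivity) (hWg m)
  have hdir : ∀ m, ∀ u ∈ Icc (0 : ℝ) 1, Tword (toWord i₁ i₂ (v m)) (emb i₁ i₂ (1 - u, u)) =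
      wordStretch n (v m) u • emb i₁ i₂ (1 - wordSlope n (v m) u, wordSlope n (v m) u) := by
    intro m u hu
    rw [Tword_emb hN h12, wordT_direction hn _ hu, map_smul]
  have hstretch : ∀ m, ∀ u ∈ Icc (0 : ℝ) 1,
      0 ≤ wordStretch n (v m) u ∧ wordStretch n (v m) u ≤ W m := by
    intro m u hu
    obtain ⟨k1, k2⟩ := weight_pos hn (v m)
    have hu1 : 0 ≤ 1 - u := by linarith [hu.2]
    have hu0 := hu.1
    rw [wordStretch, hv]
    refine ⟨by positivity, div_le_div_of_nonneg_right ?_ (by positivity)⟩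
    nlinarith
  -- the norm of the chord of the cell bounds the Hilbert-Schmidt norm from below
  have hlow : ∀ m, W m / 4 ≤ 2 * √(hsNormSq (Tword (toWord i₁ i₂ (v m)))) := by
    intro m
    have hhalf : (1 / 2 : ℝ) ∈ Icc (0 : ℝ) 1 := by constructor <;> norm_num
    have h1 := norm_apply_le (Tword (toWord i₁ i₂ (v m))) (emb i₁ i₂ (1 - 1 / 2, 1 / 2))
    have h2 : ‖emb i₁ i₂ ((1 - 1 / 2, 1 / 2) : ℝ × ℝ)‖ ≤ 1 := by
      rw [show emb i₁ i₂ ((1 - 1 / 2, 1 / 2) : ℝ × ℝ) = (1 / 2 : ℝ) • (p i₂ - p i₁) by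
        rw [emb_apply]; module, norm_smul,
        Real.norm_of_nonneg (by norm_num)]
      linarith [norm_chord_le hN (i₁ := i₁) (i₂ := i₂)]
    have h3 : wordStretch n (v m) (1 / 2) = W m / 2 := by
      rw [wordStretch, hv, hW]
      ring
    rw [hdir m _ hhalf, norm_smul, Real.norm_of_nonneg (hstretch m _ hhalf).1, h3] at h1
    have h4 : 1 / 2 ≤
        2 * ‖emb i₁ i₂ (1 - wordSlope n (v m) (1 / 2), wordSlope n (v m) (1 / 2))‖ := by
      have h5 := real_inner_le_norm (p i₂ - p i₁)
        (emb i₁ i₂ (1 - wordSlope n (v m) (1 / 2), wordSlope n (v m) (1 / 2)))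
      rw [inner_chord_emb hN h12] at h5
      simp only [sub_add_cancel] at h5
      exact h5.trans (mul_le_mul_of_nonneg_right (norm_chord_le hN) (norm_nonneg _))
    have h6 := mul_le_mul_of_nonneg_left h4 (hW0 m).le
    have h7 := mul_le_mul_of_nonneg_left h2
      (Real.sqrt_nonneg (hsNormSq (Tword (toWord i₁ i₂ (v m)))))
    nlinarith
  have hpos : ∀ m, 0 < hsNormSq (Tword (toWord i₁ i₂ (v m))) := fun m =>
    Real.sqrt_pos.1 (by linarith [hlow m, hW0 m])
  have hd : emb i₁ i₂ (1 - σ, σ) ≠ 0 := by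
    intro h
    have := inner_chord_emb hN h12 (1 - σ, σ)
    rw [h, inner_zero_right] at this
    norm_num at this
  set Q := (Submodule.span ℝ {emb i₁ i₂ (1 - σ, σ)}).starProjection with hQ
  have hQle : ∀ y z, ‖y - z - Q (y - z)‖ ≤ ‖y - z‖ := by
    intro y z
    rw [hQ, ← Submodule.starProjection_orthogonal_val]
    exact Submodule.norm_starProjection_apply_le _ _
  have hQd : Q (emb i₁ i₂ (1 - σ, σ)) = emb i₁ i₂ (1 - σ, σ) :=
    Submodule.starProjection_eq_self_iff.2 (Submodule.mem_span_singleton_self _)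
  set ε : ℕ → ℝ := fun m => 2 * (n ^ 2 * (n / growth n ^ 2) ^ m) with hε
  have hplane : ∀ m, ∀ u ∈ Icc (0 : ℝ) 1,
      ‖Tword (toWord i₁ i₂ (v m)) (emb i₁ i₂ (1 - u, u)) -
        Q (Tword (toWord i₁ i₂ (v m)) (emb i₁ i₂ (1 - u, u)))‖ ≤ W m * ε m := by
    intro m u hu
    obtain ⟨u', hu', hσ'⟩ := hσ m
    have h1 := wordSlope_sub_le_cell hn (v m) hu hu'
    have h2 := wordSlope_sub_le_cell hn (v m) hu' hu
    rw [hv, hσ'] at h1 h2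
    have h3 := norm_emb_direction_sub hN (i₁ := i₁) (i₂ := i₂) σ (wordSlope n (v m) u)
    have h4 := hQle (emb i₁ i₂ (1 - wordSlope n (v m) u, wordSlope n (v m) u))
      (emb i₁ i₂ (1 - σ, σ))
    rw [map_sub Q, hQd, sub_sub_sub_cancel_right] at h4
    rw [hdir m u hu, map_smul, ← smul_sub, norm_smul, Real.norm_of_nonneg (hstretch m u hu).1]
    refine mul_le_mul (hstretch m u hu).2 (h4.trans (h3.trans ?_)) (norm_nonneg _) (hW0 m).le
    exact mul_le_mul_of_nonneg_left (abs_le.2 ⟨by linarith, h2⟩) zero_le_two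
  refine tendsto_normalized hd hpos fun z => ?_
  obtain ⟨a, b, y, hy1, hy2, rfl⟩ := exists_decomposition i₁ i₂ z
  set δ : ℕ → ℝ := fun m => (|a| + |b|) * ε m + (1 / growth n) ^ m * ‖y‖ with hδ
  have hδ0 : Tendsto δ atTop (𝓝 0) := by
    have h1 := ((tendsto_cell hn).const_mul 2).const_mul (|a| + |b|)
    have h2 := (tendsto_pow_atTop_nhds_zero_of_lt_one (by positivity : 0 ≤ 1 / growth n)
      (by rw [div_lt_one (by linarith)]; linarith)).mul_const ‖y‖
    have := h1.add h2
    rwa [mul_zero, mul_zero, zero_mul, add_zero] at this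
  have hbound : ∀ m, ‖Tword (toWord i₁ i₂ (v m))
      (a • emb i₁ i₂ (1, 0) + b • emb i₁ i₂ (0, 1) + y) - Q (Tword (toWord i₁ i₂ (v m))
      (a • emb i₁ i₂ (1, 0) + b • emb i₁ i₂ (0, 1) + y))‖ ≤ W m * δ m := by
    intro m
    have h0 := hplane m 0 ⟨le_rfl, zero_le_one⟩
    have h1 := hplane m 1 ⟨zero_le_one, le_rfl⟩
    rw [sub_zero] at h0
    rw [sub_self] at h1
    have h2 : ‖Tword (toWord i₁ i₂ (v m)) y - Q (Tword (toWord i₁ i₂ (v m)) y)‖ ≤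
        W m * ((1 / growth n) ^ m * ‖y‖) := by
      have h3 := hQle (Tword (toWord i₁ i₂ (v m)) y) 0
      rw [sub_zero] at h3
      refine h3.trans ?_
      rw [Tword_of_orthogonal hN hy1 hy2, norm_smul, hv, Real.norm_of_nonneg (by positivity),
        ← mul_assoc]
      refine mul_le_mul_of_nonneg_right ?_ (norm_nonneg _)
      calc (1 / (n + 2)) ^ m = (growth n / (n + 2)) ^ m * (1 / growth n) ^ m := by
            rw [← mul_pow]
            congr 1
            field_simp
        _ ≤ _ := mul_le_mul_of_nonneg_right (hWg m) (by positivity)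
    set A := Tword (toWord i₁ i₂ (v m))
    have e : A (a • emb i₁ i₂ (1, 0) + b • emb i₁ i₂ (0, 1) + y) -
        Q (A (a • emb i₁ i₂ (1, 0) + b • emb i₁ i₂ (0, 1) + y)) =
        a • (A (emb i₁ i₂ (1, 0)) - Q (A (emb i₁ i₂ (1, 0)))) +
        b • (A (emb i₁ i₂ (0, 1)) - Q (A (emb i₁ i₂ (0, 1)))) + (A y - Q (A y)) := by
      simp only [map_add, map_smul]
      module
    rw [e]
    calc _ ≤ |a| * ‖A (emb i₁ i₂ (1, 0)) - Q (A (emb i₁ i₂ (1, 0)))‖ +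
          |b| * ‖A (emb i₁ i₂ (0, 1)) - Q (A (emb i₁ i₂ (0, 1)))‖ + ‖A y - Q (A y)‖ := by
          rw [← Real.norm_eq_abs, ← Real.norm_eq_abs, ← norm_smul, ← norm_smul]
          exact norm_add₃_le
      _ ≤ |a| * (W m * ε m) + |b| * (W m * ε m) + W m * ((1 / growth n) ^ m * ‖y‖) := by gcongr
      _ = W m * δ m := by rw [hδ]; ring
  refine squeeze_zero (g := fun m => 64 * δ m ^ 2)
    (fun m => div_nonneg (sq_nonneg _) (hpos m).le) (fun m => ?_) ?_
  · rw [div_le_iff₀ (hpos m)]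
    have h1 := hlow m
    have h2 : (W m) ^ 2 ≤ 64 * hsNormSq (Tword (toWord i₁ i₂ (v m))) := by
      have h3 := pow_le_pow_left₀ (by linarith [hW0 m] : 0 ≤ W m / 4) h1 2
      rw [mul_pow, Real.sq_sqrt (hpos m).le] at h3
      linarith
    calc _ ≤ (W m * δ m) ^ 2 := pow_le_pow_left₀ (norm_nonneg _) (hbound m) 2
      _ = W m ^ 2 * δ m ^ 2 := by ring
      _ ≤ 64 * hsNormSq (Tword (toWord i₁ i₂ (v m))) * δ m ^ 2 := by gcongr
      _ = _ := by ring
  · have := (hδ0.pow 2).const_mul 64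
    simpa using this

/-! ### The set `Γ` -/

lemma exists_cons_eq_letter (b : Bool) : ∃ k, ![S i₁, S i₂] k = S (letter i₁ i₂ b) := by
  cases b
  · exact ⟨0, rfl⟩
  · exact ⟨1, rfl⟩

lemma cons_eq_letter (k : Fin 2) : ∃ b, ![S i₁, S i₂] k = S (letter i₁ i₂ b) := by
  fin_cases k
  · exact ⟨false, rfl⟩
  · exact ⟨true, rfl⟩

lemma lipschitzWith_cons (hN : 2 ≤ N) (k : Fin 2) :
    LipschitzWith (Real.toNNReal (N / (N + 2))) (![S i₁, S i₂] k) := by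
  obtain ⟨b, hb⟩ := cons_eq_letter (i₁ := i₁) (i₂ := i₂) k
  rw [hb]
  exact lipschitzWith_S hN _

lemma continuous_emb : Continuous (emb i₁ i₂) := by
  have : (emb i₁ i₂ : ℝ × ℝ → Y N) = fun z => z.2 • p i₂ - z.1 • p i₁ := rfl
  rw [this]
  fun_prop

lemma isAttractor_image (hN : 2 ≤ N) (h12 : i₁ ≠ i₂) (hP : IsSlopeParam N P) :
    IsAttractor ![S i₁, S i₂] ((fun u => emb i₁ i₂ (P u)) '' Icc 0 1) := by
  have hn : (2 : ℝ) ≤ N := by exact_mod_cast hN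
  refine ⟨(nonempty_Icc.2 zero_le_one).image _,
    isCompact_Icc.image (continuous_emb.comp hP.continuous), ?_⟩
  ext x
  simp only [mem_iUnion]
  constructor
  · rintro ⟨u, hu, rfl⟩
    obtain ⟨b, u', hu', rfl⟩ := exists_slopeMap_eq hn hu
    obtain ⟨k, hk⟩ := exists_cons_eq_letter (i₁ := i₁) (i₂ := i₂) b
    refine ⟨k, _, mem_image_of_mem _ hu', ?_⟩
    simp only
    rw [hk, S_emb hN h12, hP.map_slopeMap b u' hu']
  · rintro ⟨k, _, ⟨u, hu, rfl⟩, rfl⟩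
    obtain ⟨b, hb⟩ := cons_eq_letter (i₁ := i₁) (i₂ := i₂) k
    refine ⟨slopeMap N b u, slopeMap_mem hn b hu, ?_⟩
    simp only
    rw [hb, S_emb hN h12, hP.map_slopeMap b u hu]

lemma curve_eq_image (hN : 2 ≤ N) (h12 : i₁ ≠ i₂) (hP : IsSlopeParam N P) {Γ : Set (Y N)}
    (hΓ : IsAttractor ![S i₁, S i₂] Γ) : Γ = (fun u => emb i₁ i₂ (P u)) '' Icc 0 1 :=
  have h := isAttractor_image hN h12 hP
  (hΓ.subset ratio_S_lt_one (lipschitzWith_cons hN) h).antisymm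
    (h.subset ratio_S_lt_one (lipschitzWith_cons hN) hΓ)

lemma curve_subset_gasket (hN : 2 ≤ N) {X Γ : Set (Y N)}
    (hX : IsAttractor (fun j : Fin N => S j) X) (hΓ : IsAttractor ![S i₁, S i₂] Γ) : Γ ⊆ X := by
  refine subset_of_subset_iUnion_image ratio_S_lt_one (lipschitzWith_cons hN) hΓ.isCompact
    hΓ.eq_iUnion.subset hX.isCompact hX.nonempty fun k => ?_
  obtain ⟨b, hb⟩ := cons_eq_letter (i₁ := i₁) (i₂ := i₂) k
  rw [hb]
  exact (subset_iUnion (fun j : Fin N => S j '' X) _).trans hX.eq_iUnion.symm.subset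

/-! ### Addresses -/

/-- The first `m` letters of `w`, last letter first. -/
def prefixWord (w : ℕ → Bool) (m : ℕ) : List Bool := ((List.range m).map w).reverse

lemma length_prefixWord (w : ℕ → Bool) (m : ℕ) : (prefixWord w m).length = m := by
  simp [prefixWord]

lemma prefixWord_succ (w : ℕ → Bool) (m : ℕ) :
    prefixWord w (m + 1) = w m :: prefixWord w m := by
  simp [prefixWord, List.range_succ]

lemma toWord_prefixWord (w : ℕ → Bool) (m : ℕ) :
    toWord i₁ i₂ (prefixWord w m) = trunc (fun k => letter i₁ i₂ (w k)) m := by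
  simp [toWord, prefixWord, trunc]

lemma continuousOn_slopeMap {n : ℝ} (hn : 2 ≤ n) (b : Bool) :
    ContinuousOn (slopeMap n b) (Icc 0 1) := by
  cases b
  · exact ContinuousOn.div (by fun_prop) (by fun_prop) fun τ hτ => by
      linarith [two_le_weight hn hτ]
  · exact ContinuousOn.div (by fun_prop) (by fun_prop) fun τ hτ => by
      linarith [two_le_weight' hn hτ]

lemma continuousOn_wordSlope {n : ℝ} (hn : 2 ≤ n) (v : List Bool) :
    ContinuousOn (wordSlope n v) (Icc 0 1) := by
  induction v with
  | nil => exact continuousOn_id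
  | cons b v ih => exact ih.comp (continuousOn_slopeMap hn b) fun u hu => slopeMap_mem hn b hu

/-- The nested cells of slopes of an infinite word have a common point. -/
lemma exists_limit_slope {n : ℝ} (hn : 2 ≤ n) (w : ℕ → Bool) :
    ∃ σ ∈ Icc (0 : ℝ) 1, ∀ m, ∃ u ∈ Icc (0 : ℝ) 1, wordSlope n (prefixWord w m) u = σ := by
  have hc : ∀ m, IsCompact (wordSlope n (prefixWord w m) '' Icc 0 1) := fun m =>
    isCompact_Icc.image_of_continuousOn (continuousOn_wordSlope hn _)
  obtain ⟨σ, hσ⟩ := IsCompact.nonempty_iInter_of_sequence_nonempty_isCompact_isClosed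
    (fun m => wordSlope n (prefixWord w m) '' Icc 0 1) (fun m => by
      rintro _ ⟨u, hu, rfl⟩
      rw [prefixWord_succ]
      exact ⟨slopeMap n (w m) u, slopeMap_mem hn _ hu, rfl⟩)
    (fun m => (nonempty_Icc.2 zero_le_one).image _) (hc 0) fun m => (hc m).isClosed
  rw [mem_iInter] at hσ
  obtain ⟨u, hu, h⟩ := hσ 0
  exact ⟨σ, h ▸ wordSlope_mem hn _ hu, hσ⟩

/-- Every slope has an address. -/
lemma exists_address {n : ℝ} (hn : 2 ≤ n) {σ : ℝ} (hσ : σ ∈ Icc (0 : ℝ) 1) :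
    ∃ w : ℕ → Bool, ∀ m, ∃ u ∈ Icc (0 : ℝ) 1, wordSlope n (prefixWord w m) u = σ := by
  have hex : ∀ τ : ℝ, ∃ (b : Bool) (u : ℝ), τ ∈ Icc (0 : ℝ) 1 →
      u ∈ Icc (0 : ℝ) 1 ∧ slopeMap n b u = τ := by
    intro τ
    by_cases hτ : τ ∈ Icc (0 : ℝ) 1
    · obtain ⟨b, u, hu, h⟩ := exists_slopeMap_eq hn hτ
      exact ⟨b, u, fun _ => ⟨hu, h⟩⟩
    · exact ⟨false, 0, fun h => absurd h hτ⟩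
  choose b u hu using hex
  refine ⟨fun m => b (u^[m] σ), fun m => ⟨u^[m] σ, ?_⟩⟩
  induction m with
  | zero => exact ⟨hσ, rfl⟩
  | succ m ih =>
    obtain ⟨h1, h2⟩ := ih
    rw [Function.iterate_succ_apply', prefixWord_succ]
    obtain ⟨h3, h4⟩ := hu _ h1
    exact ⟨h3, by rw [wordSlope, Function.comp_apply, h4, h2]⟩

/-- The point of slope `σ` lies in all the cells of an address of `σ`. -/
lemma mem_image_Sword (hN : 2 ≤ N) (h12 : i₁ ≠ i₂) (hP : IsSlopeParam N P) {X Γ : Set (Y N)}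
    (hX : IsAttractor (fun j : Fin N => S j) X) (hΓ : IsAttractor ![S i₁, S i₂] Γ)
    {w : ℕ → Bool} {σ : ℝ}
    (hw : ∀ m, ∃ u ∈ Icc (0 : ℝ) 1, wordSlope N (prefixWord w m) u = σ) :
    emb i₁ i₂ (P σ) ∈ ⋂ m, Sword (trunc (fun k => letter i₁ i₂ (w k)) m) '' X := by
  have hn : (2 : ℝ) ≤ N := by exact_mod_cast hN
  refine mem_iInter.2 fun m => ?_
  obtain ⟨u, hu, rfl⟩ := hw m
  refine ⟨emb i₁ i₂ (P u), curve_subset_gasket hN hX hΓ ?_, ?_⟩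
  · rw [curve_eq_image hN h12 hP hΓ]
    exact mem_image_of_mem _ hu
  · rw [← toWord_prefixWord, Sword_emb hN h12, hP.map_wordSlope hn _ hu]

/-- The cells of an infinite word have at most one common point. -/
lemma subsingleton_iInter_Sword (hN : 2 ≤ N) {X : Set (Y N)} (hX : IsCompact X)
    (w : ℕ → Fin N) : (⋂ m, Sword (trunc w m) '' X).Subsingleton := by
  intro x hx y hy
  have hbound : ∀ m : ℕ,
      dist x y ≤ (Real.toNNReal ((N : ℝ) / (N + 2)) : ℝ) ^ m * Metric.diam X := by
    intro m
    obtain ⟨a, ha, rfl⟩ := mem_iInter.1 hx m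
    obtain ⟨b, hb, rfl⟩ := mem_iInter.1 hy m
    have h := (lipschitzWith_Sword hN (trunc w m)).dist_le_mul a b
    have hlen : (trunc w m).length = m := by simp [trunc]
    rw [hlen, NNReal.coe_pow] at h
    exact h.trans (mul_le_mul_of_nonneg_left
      (Metric.dist_le_diam_of_mem hX.isBounded ha hb) (by positivity))
  have hlim := (tendsto_pow_atTop_nhds_zero_of_lt_one (NNReal.coe_nonneg _)
    (by exact_mod_cast ratio_S_lt_one (N := N) :
      (Real.toNNReal ((N : ℝ) / (N + 2)) : ℝ) < 1)).mul_const (Metric.diam X)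
  rw [zero_mul] at hlim
  exact dist_le_zero.1 (ge_of_tendsto' hlim hbound)

/-! ### Regular parametrizations -/

/-- `τ t` is the slope of the curve at its point of abscissa `2 t - 1`, where `t ∈ [0, 1]`. It is
Hölder continuous with exponent `r`, and `2 τ` is the derivative of the second coordinate of this
point with respect to `t`. -/
structure IsGraphSlope (P : ℝ → ℝ × ℝ) (r : ℝ) (τ : ℝ → ℝ) : Prop where
  mem : ∀ t ∈ Icc (0 : ℝ) 1, τ t ∈ Icc (0 : ℝ) 1
  abscissa_eq : ∀ t ∈ Icc (0 : ℝ) 1, abscissa P (τ t) = 2 * t - 1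
  holder : ∃ C : ℝ, 0 < C ∧ ∀ s ∈ Icc (0 : ℝ) 1, ∀ t ∈ Icc (0 : ℝ) 1,
    |τ t - τ s| ≤ C * |t - s| ^ r
  hasDeriv : ∀ t ∈ Icc (0 : ℝ) 1,
    HasDerivWithinAt (fun t => (P (τ t)).2) (2 * τ t) (Icc 0 1) t

/-- The graph parametrization of the curve. -/
noncomputable def graphParam (i₁ i₂ : Fin N) (P : ℝ → ℝ × ℝ) (τ : ℝ → ℝ) (t : ℝ) : Y N :=
  emb i₁ i₂ (P (τ t))

namespace IsGraphSlope
variable {r : ℝ} {τ : ℝ → ℝ}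

lemma hasDerivWithinAt (h : IsGraphSlope P r τ) {t : ℝ} (ht : t ∈ Icc (0 : ℝ) 1) :
    HasDerivWithinAt (graphParam i₁ i₂ P τ) ((2 : ℝ) • emb i₁ i₂ (1 - τ t, τ t)) (Icc 0 1) t := by
  have h2 := h.hasDeriv t ht
  have h1 : HasDerivWithinAt (fun t => (P (τ t)).1) (2 - 2 * τ t) (Icc 0 1) t := by
    have h3 : HasDerivWithinAt (fun t : ℝ => 2 * t - 1) 2 (Icc 0 1) t := by
      simpa using ((hasDerivWithinAt_id t (Icc (0 : ℝ) 1)).const_mul 2).sub_const 1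
    refine (h3.sub h2).congr_of_mem (fun s hs => ?_) ht
    have := h.abscissa_eq s hs
    simp only [abscissa] at this
    simp only [Pi.sub_apply]
    linarith
  have h4 := (h2.smul_const (p i₂)).sub (h1.smul_const (p i₁))
  refine h4.congr_deriv ?_
  rw [emb_apply]
  module

lemma derivWithin_eq (h : IsGraphSlope P r τ) {t : ℝ} (ht : t ∈ Icc (0 : ℝ) 1) :
    derivWithin (graphParam i₁ i₂ P τ) (Icc 0 1) t = (2 : ℝ) • emb i₁ i₂ (1 - τ t, τ t) :=
  (h.hasDerivWithinAt ht).derivWithin (uniqueDiffOn_Icc zero_lt_one t ht)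

lemma inner_graphParam (hN : 2 ≤ N) (h12 : i₁ ≠ i₂) (h : IsGraphSlope P r τ) {t : ℝ}
    (ht : t ∈ Icc (0 : ℝ) 1) : inner ℝ (p i₂ - p i₁) (graphParam i₁ i₂ P τ t) = t - 1 / 2 := by
  rw [graphParam, inner_chord_emb hN h12]
  have := h.abscissa_eq t ht
  rw [abscissa] at this
  rw [this]
  ring

lemma apply_eq (hN : 2 ≤ N) (hP : IsSlopeParam N P) (h : IsGraphSlope P r τ) {t u : ℝ}
    (ht : t ∈ Icc (0 : ℝ) 1) (hu : u ∈ Icc (0 : ℝ) 1) (htu : abscissa P u = 2 * t - 1) :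
    τ t = u :=
  hP.abscissa_injOn (by exact_mod_cast hN) (h.mem t ht) hu ((h.abscissa_eq t ht).trans htu.symm)

lemma map_zero (hN : 2 ≤ N) (hP : IsSlopeParam N P) (h : IsGraphSlope P r τ) : τ 0 = 0 :=
  h.apply_eq hN hP ⟨le_rfl, zero_le_one⟩ ⟨le_rfl, zero_le_one⟩ (by rw [hP.abscissa_zero]; ring)

lemma map_one (hN : 2 ≤ N) (hP : IsSlopeParam N P) (h : IsGraphSlope P r τ) : τ 1 = 1 :=
  h.apply_eq hN hP ⟨zero_le_one, le_rfl⟩ ⟨zero_le_one, le_rfl⟩ (by rw [hP.abscissa_one]; ring)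

lemma continuousOn (h : IsGraphSlope P r τ) (hr : 0 < r) : ContinuousOn τ (Icc 0 1) := by
  obtain ⟨C, -, hC⟩ := h.holder
  intro t ht
  refine tendsto_iff_dist_tendsto_zero.2 ?_
  have h1 : Continuous fun s => C * |s - t| ^ r :=
    continuous_const.mul ((continuous_id.sub continuous_const).abs.rpow_const
      fun _ => Or.inr hr.le)
  have h2 : Tendsto (fun s => C * |s - t| ^ r) (𝓝[Icc 0 1] t) (𝓝 0) := by
    have := h1.tendsto t
    simp only [sub_self, abs_zero, Real.zero_rpow hr.ne', mul_zero] at this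
    exact this.mono_left nhdsWithin_le_nhds
  refine squeeze_zero' (Eventually.of_forall fun s => dist_nonneg) ?_ h2
  filter_upwards [self_mem_nhdsWithin] with s hs
  exact hC t ht s hs

lemma image_eq (hP : IsSlopeParam N P) (hN : 2 ≤ N) (h : IsGraphSlope P r τ) :
    graphParam i₁ i₂ P τ '' Icc 0 1 = (fun u => emb i₁ i₂ (P u)) '' Icc 0 1 := by
  ext x
  constructor
  · rintro ⟨t, ht, rfl⟩
    exact ⟨τ t, h.mem t ht, rfl⟩
  · rintro ⟨u, hu, rfl⟩
    have h0 := hP.abscissa_mono ⟨le_rfl, zero_le_one⟩ hu hu.1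
    have h1 := hP.abscissa_mono hu ⟨zero_le_one, le_rfl⟩ hu.2
    rw [hP.abscissa_zero] at h0
    rw [hP.abscissa_one] at h1
    have ht : (abscissa P u + 1) / 2 ∈ Icc (0 : ℝ) 1 := ⟨by linarith, by linarith⟩
    refine ⟨_, ht, ?_⟩
    simp only [graphParam]
    rw [h.apply_eq hN hP ht hu (by ring)]

lemma isRegularArcParam (hN : 2 ≤ N) (h12 : i₁ ≠ i₂) (hP : IsSlopeParam N P)
    (h : IsGraphSlope P r τ) (hr : 0 < r) {Γ : Set (Y N)}
    (hΓ : IsAttractor ![S i₁, S i₂] Γ) :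
    IsRegularArcParam 1 (graphParam i₁ i₂ P τ) Γ (p i₁) (p i₂) where
  contDiffOn := by
    rw [Nat.cast_one, contDiffOn_one_iff_derivWithin (uniqueDiffOn_Icc zero_lt_one)]
    refine ⟨fun t ht => (h.hasDerivWithinAt ht).differentiableWithinAt, ?_⟩
    have hτ := h.continuousOn hr
    have hτ' : ContinuousOn (fun t => (1 - τ t, τ t)) (Icc 0 1) :=
      (continuousOn_const.sub hτ).prodMk hτ
    have : ContinuousOn (fun t => (2 : ℝ) • emb i₁ i₂ (1 - τ t, τ t)) (Icc 0 1) :=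
      (continuous_emb.comp_continuousOn hτ').const_smul (2 : ℝ)
    exact this.congr fun t ht => h.derivWithin_eq ht
  derivWithin_ne_zero t ht h0 := by
    have h1 := inner_chord_emb hN h12 (1 - τ t, τ t)
    rw [h.derivWithin_eq ht, smul_eq_zero_iff_right two_ne_zero] at h0
    rw [h0, inner_zero_right] at h1
    norm_num at h1
  image_eq := by rw [h.image_eq hP hN, curve_eq_image hN h12 hP hΓ]
  injOn s hs t ht hst := by
    have h1 := h.inner_graphParam hN h12 hs
    rw [hst, h.inner_graphParam hN h12 ht] at h1
    linarith
  map_zero := by rw [graphParam, h.map_zero hN hP, hP.map_zero, emb_planeV]; rfl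
  map_one := by rw [graphParam, h.map_one hN hP, hP.map_one, emb_planeV]; rfl

lemma holderOnWith_derivWithin (hN : 2 ≤ N) (h : IsGraphSlope P r τ) (hr : 0 < r) :
    ∃ C : ℝ≥0, HolderOnWith C r.toNNReal
      (derivWithin (graphParam i₁ i₂ P τ) (Icc 0 1)) (Icc 0 1) := by
  obtain ⟨C, hC, hτ⟩ := h.holder
  refine ⟨(4 * C).toNNReal, fun s hs t ht => ?_⟩
  have h1 : dist (derivWithin (graphParam i₁ i₂ P τ) (Icc 0 1) s)
      (derivWithin (graphParam i₁ i₂ P τ) (Icc 0 1) t) ≤ 4 * C * dist s t ^ r := by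
    rw [h.derivWithin_eq hs, h.derivWithin_eq ht, dist_eq_norm, ← smul_sub, norm_smul,
      Real.norm_of_nonneg zero_le_two, Real.dist_eq]
    have h2 := norm_emb_direction_sub hN (i₁ := i₁) (i₂ := i₂) (τ t) (τ s)
    linarith [hτ t ht s hs]
  rw [edist_dist, edist_dist, Real.coe_toNNReal r hr.le,
    ENNReal.ofReal_rpow_of_nonneg dist_nonneg hr.le, ← ENNReal.ofReal_coe_nnreal,
    Real.coe_toNNReal _ (by positivity), ← ENNReal.ofReal_mul (by positivity)]
  exact ENNReal.ofReal_le_ofReal h1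

/-- Every regular parametrization factors through the graph parametrization; in particular its
derivative is a multiple of the graph direction. -/
lemma param_eq (hN : 2 ≤ N) (h12 : i₁ ≠ i₂) (hP : IsSlopeParam N P) (h : IsGraphSlope P r τ)
    {Γ : Set (Y N)} (hΓ : IsAttractor ![S i₁, S i₂] Γ) {g : ℝ → Y N}
    (hg : g '' Icc 0 1 = Γ) {t : ℝ} (ht : t ∈ Icc (0 : ℝ) 1) :
    inner ℝ (p i₂ - p i₁) (g t) + 1 / 2 ∈ Icc (0 : ℝ) 1 ∧
      g t = graphParam i₁ i₂ P τ (inner ℝ (p i₂ - p i₁) (g t) + 1 / 2) := by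
  have hmem : g t ∈ graphParam i₁ i₂ P τ '' Icc 0 1 := by
    rw [h.image_eq hP hN, ← curve_eq_image hN h12 hP hΓ, ← hg]
    exact mem_image_of_mem _ ht
  obtain ⟨a, ha, hat⟩ := hmem
  have := h.inner_graphParam (i₁ := i₁) (i₂ := i₂) hN h12 ha
  rw [← hat, this, sub_add_cancel]
  exact ⟨ha, rfl⟩

lemma derivWithin_param (hN : 2 ≤ N) (h12 : i₁ ≠ i₂) (hP : IsSlopeParam N P)
    (h : IsGraphSlope P r τ) {Γ : Set (Y N)} (hΓ : IsAttractor ![S i₁, S i₂] Γ) {g : ℝ → Y N}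
    (hg : g '' Icc 0 1 = Γ) (hd : DifferentiableOn ℝ g (Icc 0 1)) {t : ℝ}
    (ht : t ∈ Icc (0 : ℝ) 1) :
    derivWithin g (Icc 0 1) t = (2 * inner ℝ (p i₂ - p i₁) (derivWithin g (Icc 0 1) t)) •
      emb i₁ i₂ (1 - τ (inner ℝ (p i₂ - p i₁) (g t) + 1 / 2),
        τ (inner ℝ (p i₂ - p i₁) (g t) + 1 / 2)) := by
  have h1 := (hd t ht).hasDerivWithinAt
  have h2 : HasDerivWithinAt (fun t => inner ℝ (p i₂ - p i₁) (g t) + 1 / 2)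
      (inner ℝ (p i₂ - p i₁) (derivWithin g (Icc 0 1) t)) (Icc 0 1) t :=
    ((innerSL ℝ (p i₂ - p i₁)).hasFDerivAt.comp_hasDerivWithinAt t h1).add_const _
  have h3 := (h.hasDerivWithinAt (i₁ := i₁) (i₂ := i₂)
    (h.param_eq hN h12 hP hΓ hg ht).1).scomp t h2
    fun s hs => (h.param_eq hN h12 hP hΓ hg hs).1
  have h4 : HasDerivWithinAt g _ (Icc 0 1) t :=
    h3.congr_of_mem (fun s hs => (h.param_eq hN h12 hP hΓ hg hs).2) ht
  conv_lhs => rw [h4.derivWithin (uniqueDiffOn_Icc zero_lt_one t ht)]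
  rw [smul_smul, mul_comm]

/-- With a `C²` parametrization the slope would be a `C¹` function with a non-zero derivative
somewhere, so slopes would grow at least linearly in the abscissa on some cell. -/
theorem not_isRegularParam_two (hN : 3 ≤ N) (h12 : i₁ ≠ i₂) (hP : IsSlopeParam N P)
    (h : IsGraphSlope P r τ) {Γ : Set (Y N)} (hΓ : IsAttractor ![S i₁, S i₂] Γ) {g : ℝ → Y N}
    (hg : IsRegularParam 2 g Γ) : False := by
  have hN2 : 2 ≤ N := by omega
  have hn : (2 : ℝ) < N := by exact_mod_cast hN
  have hu := uniqueDiffOn_Icc (zero_lt_one (α := ℝ))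
  have hg2 : ContDiffOn ℝ 2 g (Icc 0 1) := hg.contDiffOn
  have hd : DifferentiableOn ℝ g (Icc 0 1) := hg2.differentiableOn two_ne_zero
  have hd1 : ContDiffOn ℝ 1 (derivWithin g (Icc 0 1)) (Icc 0 1) :=
    hg2.derivWithin hu (by norm_num)
  set e := p i₂ - p i₁ with he
  set a : ℝ → ℝ := fun t => inner ℝ e (g t) + 1 / 2 with ha_def
  have ha : ContDiffOn ℝ 1 a (Icc 0 1) :=
    ((innerSL ℝ e).contDiff.comp_contDiffOn (hg2.of_le one_le_two)).add contDiffOn_const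
  have hder : ∀ t ∈ Icc (0 : ℝ) 1, derivWithin g (Icc 0 1) t =
      (2 * inner ℝ e (derivWithin g (Icc 0 1) t)) • emb i₁ i₂ (1 - τ (a t), τ (a t)) := fun t ht =>
    h.derivWithin_param hN2 h12 hP hΓ hg.image_eq hd ht
  have ha0 : ∀ t ∈ Icc (0 : ℝ) 1, inner ℝ e (derivWithin g (Icc 0 1) t) ≠ 0 := by
    intro t ht h0
    have h1 := hder t ht
    rw [h0, mul_zero, zero_smul] at h1
    exact hg.derivWithin_ne_zero t ht h1
  have hκ : (1 / 2 - 1 / (N : ℝ)) ≠ 0 := by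
    have : 1 / (N : ℝ) < 1 / 2 := one_div_lt_one_div_of_lt two_pos hn
    linarith
  -- the slope, expressed through the derivative of `g`
  set q : ℝ → ℝ := fun t => (inner ℝ (p i₁ + p i₂) (derivWithin g (Icc 0 1) t) /
    (inner ℝ e (derivWithin g (Icc 0 1) t)) / (1 / 2 - 1 / (N : ℝ)) + 2) / 4 with hq_def
  have hq : ContDiffOn ℝ 1 q (Icc 0 1) :=
    (((((innerSL ℝ (p i₁ + p i₂)).contDiff.comp_contDiffOn hd1).div
      ((innerSL ℝ e).contDiff.comp_contDiffOn hd1) ha0).div_const _).add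
      contDiffOn_const).div_const _
  have hqτ : ∀ t ∈ Icc (0 : ℝ) 1, q t = τ (a t) := by
    intro t ht
    have h1 := congrArg (fun z => inner ℝ (p i₁ + p i₂) z) (hder t ht)
    simp only [inner_smul_right_Y, inner_add_emb hN2 h12] at h1
    have h2 := ha0 t ht
    simp only [hq_def]
    rw [h1]
    generalize 1 / 2 - 1 / (N : ℝ) = κ at hκ ⊢
    generalize inner ℝ e (derivWithin g (Icc 0 1) t) = x at h2 ⊢
    field_simp
    ring
  have hbdd : ∀ t ∈ Icc (0 : ℝ) 1, q t ∈ Icc (0 : ℝ) 1 := fun t ht => by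
    rw [hqτ t ht]
    exact h.mem _ (h.param_eq hN2 h12 hP hΓ hg.image_eq ht).1
  have hends : ∀ u ∈ Icc (0 : ℝ) 1, ∃ t ∈ Icc (0 : ℝ) 1, q t = τ u := by
    intro u hu
    have : graphParam i₁ i₂ P τ u ∈ g '' Icc 0 1 := by
      rw [hg.image_eq, curve_eq_image hN2 h12 hP hΓ, ← h.image_eq hP hN2]
      exact mem_image_of_mem _ hu
    obtain ⟨t, ht, htu⟩ := this
    refine ⟨t, ht, ?_⟩
    rw [hqτ t ht]
    simp only [ha_def]
    rw [htu, h.inner_graphParam hN2 h12 hu, sub_add_cancel]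
  obtain ⟨t₀, ht₀, hq₀⟩ := hends 0 ⟨le_rfl, zero_le_one⟩
  obtain ⟨t₁, ht₁, hq₁⟩ := hends 1 ⟨zero_le_one, le_rfl⟩
  rw [h.map_zero hN2 hP] at hq₀
  rw [h.map_one hN2 hP] at hq₁
  have hcd : ∀ t ∈ Ioo (0 : ℝ) 1, ContDiffAt ℝ 1 q t := fun t ht =>
    hq.contDiffAt (Icc_mem_nhds ht.1 ht.2)
  obtain ⟨c, hc, hc0⟩ : ∃ c ∈ Ioo (0 : ℝ) 1, deriv q c ≠ 0 := by
    have mvt : ∀ s ∈ Icc (0 : ℝ) 1, ∀ t ∈ Icc (0 : ℝ) 1, s < t → q s ≠ q t →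
        ∃ c ∈ Ioo (0 : ℝ) 1, deriv q c ≠ 0 := by
      intro s hs t ht hst hne
      have hsub : Ioo s t ⊆ Ioo 0 1 := Ioo_subset_Ioo hs.1 ht.2
      obtain ⟨c, hc, hc'⟩ := exists_deriv_eq_slope q hst
        (hq.continuousOn.mono (Icc_subset_Icc hs.1 ht.2))
        fun x hx => ((hcd x (hsub hx)).differentiableAt one_ne_zero).differentiableWithinAt
      refine ⟨c, hsub hc, ?_⟩
      rw [hc']
      exact div_ne_zero (sub_ne_zero.2 hne.symm) (by linarith)
    rcases lt_trichotomy t₀ t₁ with hlt | heq | hlt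
    · exact mvt t₀ ht₀ t₁ ht₁ hlt (by rw [hq₀, hq₁]; exact zero_ne_one)
    · rw [heq, hq₁] at hq₀
      exact absurd hq₀ one_ne_zero
    · exact mvt t₁ ht₁ t₀ ht₀ hlt (by rw [hq₀, hq₁]; exact one_ne_zero)
  obtain ⟨K, U, hU, hK⟩ := (ha.contDiffAt (Icc_mem_nhds hc.1 hc.2)).exists_lipschitzOnWith
  -- near `c`, the function `q` expands distances by a positive factor
  have hexp : ∀ᶠ x in 𝓝 (c, c), |deriv q c| / 2 * |x.1 - x.2| ≤ |q x.1 - q x.2| := by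
    have hs := (hcd c hc).hasStrictDerivAt one_ne_zero
    have hs' := (hs.hasStrictFDerivAt.isLittleO).def (half_pos (abs_pos.2 hc0))
    filter_upwards [hs'] with x hx
    simp only [Real.norm_eq_abs, ContinuousLinearMap.toSpanSingleton_apply, smul_eq_mul] at hx
    have h1 := abs_sub_abs_le_abs_sub ((x.1 - x.2) * deriv q c) (q x.1 - q x.2)
    rw [abs_mul, abs_sub_comm (_ * _)] at h1
    linarith
  rw [nhds_prod_eq, eventually_prod_self_iff'] at hexp
  obtain ⟨V, hV, hVexp⟩ := hexp
  obtain ⟨ε, hε, hball⟩ := Metric.nhds_basis_closedBall.mem_iff.1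
    (inter_mem (inter_mem hU hV) (Icc_mem_nhds hc.1 hc.2))
  rw [Real.closedBall_eq_Icc] at hball
  have hlt : c - ε < c + ε := by linarith
  have hcl : c - ε ∈ Icc (c - ε) (c + ε) := ⟨le_rfl, hlt.le⟩
  have hcr : c + ε ∈ Icc (c - ε) (c + ε) := ⟨hlt.le, le_rfl⟩
  have hexp' : ∀ x ∈ Icc (c - ε) (c + ε), ∀ y ∈ Icc (c - ε) (c + ε),
      |deriv q c| / 2 * |x - y| ≤ |q x - q y| := fun x hx y hy =>
    hVexp x (hball hx).1.2 y (hball hy).1.2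
  have hne : q (c - ε) ≠ q (c + ε) := by
    intro heq
    have h1 := hexp' _ hcl _ hcr
    rw [heq, sub_self, abs_zero] at h1
    have h2 : 0 < |deriv q c| / 2 * |c - ε - (c + ε)| :=
      mul_pos (half_pos (abs_pos.2 hc0)) (abs_pos.2 (by linarith))
    linarith
  have hqc : ContinuousOn q (uIcc (c - ε) (c + ε)) := by
    rw [uIcc_of_le hlt.le]
    exact hq.continuousOn.mono fun x hx => (hball hx).2
  have hivt := intermediate_value_uIcc hqc
  rw [uIcc_of_le hlt.le] at hivt
  set D := |deriv q c| / 2 with hD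
  have hD0 : 0 < D := half_pos (abs_pos.2 hc0)
  have hmin : min (q (c - ε)) (q (c + ε)) ∈ Icc (0 : ℝ) 1 := by
    rcases min_choice (q (c - ε)) (q (c + ε)) with h' | h' <;> rw [h']
    · exact hbdd _ (hball hcl).2
    · exact hbdd _ (hball hcr).2
  have hmax : max (q (c - ε)) (q (c + ε)) ∈ Icc (0 : ℝ) 1 := by
    rcases max_choice (q (c - ε)) (q (c + ε)) with h' | h' <;> rw [h']
    · exact hbdd _ (hball hcl).2
    · exact hbdd _ (hball hcr).2
  obtain ⟨x, hx, y, hy, hxy, hlt'⟩ := hP.not_expanding hn hmin hmax (min_lt_max.2 hne)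
    (by positivity : 0 < D / (2 * (K + 1)))
  obtain ⟨s, hs, rfl⟩ := hivt hx
  obtain ⟨t, ht, rfl⟩ := hivt hy
  have h1 := hexp' t ht s hs
  rw [abs_of_nonneg (sub_nonneg.2 hxy)] at h1
  have hpt : ∀ t ∈ Icc (c - ε) (c + ε), abscissa P (q t) = 2 * a t - 1 := fun t ht => by
    rw [hqτ t (hball ht).2]
    exact h.abscissa_eq _ (h.param_eq hN2 h12 hP hΓ hg.image_eq (hball ht).2).1
  rw [hpt s hs, hpt t ht] at hlt'
  have h2 := hK.dist_le_mul t (hball ht).1.1 s (hball hs).1.1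
  rw [Real.dist_eq, Real.dist_eq] at h2
  have h3 : D / (2 * (K + 1)) * (2 * a t - 1 - (2 * a s - 1)) ≤ D * |t - s| := by
    have hK0 : (0 : ℝ) ≤ K := K.2
    calc D / (2 * (K + 1)) * (2 * a t - 1 - (2 * a s - 1)) = D / (K + 1) * (a t - a s) := by
          field_simp
          ring
      _ ≤ D / (K + 1) * ((K + 1) * |t - s|) := by
          refine mul_le_mul_of_nonneg_left ?_ (by positivity)
          nlinarith [le_abs_self (a t - a s), abs_nonneg (t - s)]
      _ = D * |t - s| := by field_simp
  linarith

end IsGraphSlope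

lemma holderExp_eq (hN : 2 ≤ N) : holderExp N = exponent N := by
  have hn : (2 : ℝ) ≤ N := by exact_mod_cast hN
  have hg := two_le_growth hn
  have hs : 1 + √(4 * (N : ℝ) + 1) = growth N * 2 := by
    unfold growth
    ring
  rw [holderExp, exponent, hs, Real.log_mul (by linarith) two_ne_zero,
    Real.log_div (by positivity) (by positivity), Real.log_div (by positivity) (by linarith),
    Real.log_pow, ← neg_div_neg_eq]
  push_cast
  congr 1 <;> ring

end HarmonicGasket

open HarmonicGasket in
theorem theorem2p1 (N : ℕ) (hN : 2 ≤ N) (i₁ i₂ : Fin N) (hi₁ : i₁ = ⟨0, by omega⟩)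
    (hi₂ : i₂ = ⟨1, by omega⟩) :
    -- the harmonic gasket `X` and the set `Γ` are well defined
    (∃! X : Set (HarmonicGasket.Y N),
      HarmonicGasket.IsAttractor (fun j : Fin N => HarmonicGasket.S j) X) ∧
    (∃! Γ : Set (HarmonicGasket.Y N),
      HarmonicGasket.IsAttractor ![HarmonicGasket.S i₁, HarmonicGasket.S i₂] Γ) ∧
    ∀ X Γ : Set (HarmonicGasket.Y N),
      HarmonicGasket.IsAttractor (fun j : Fin N => HarmonicGasket.S j) X →
      HarmonicGasket.IsAttractor ![HarmonicGasket.S i₁, HarmonicGasket.S i₂] Γ →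
      -- `Γ` is a plane `C^1` curve from `p_1` to `p_2`
      Γ ⊆ Submodule.span ℝ {HarmonicGasket.p i₁, HarmonicGasket.p i₂} ∧
      (∃ g : ℝ → HarmonicGasket.Y N, HarmonicGasket.IsRegularArcParam 1 g Γ
        (HarmonicGasket.p i₁) (HarmonicGasket.p i₂)) ∧
      (3 ≤ N →
        -- it is not `C^2`
        (¬ ∃ g : ℝ → HarmonicGasket.Y N, HarmonicGasket.IsRegularParam 2 g Γ) ∧
        -- it has a parametrization with Hölder continuous derivative
        0 < HarmonicGasket.holderExp N ∧
        ∃ g : ℝ → HarmonicGasket.Y N, HarmonicGasket.IsRegularArcParam 1 g Γ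
          (HarmonicGasket.p i₁) (HarmonicGasket.p i₂) ∧
          ∃ C : ℝ≥0, HolderOnWith C (HarmonicGasket.holderExp N).toNNReal
            (derivWithin g (Icc 0 1)) (Icc 0 1)) ∧
      -- every point of `Γ` has an address in the letters `1, 2`
      (∀ x ∈ Γ, ∃ w : ℕ → Fin N, (∀ n, w n = i₁ ∨ w n = i₂) ∧
        ⋂ m, HarmonicGasket.Sword (HarmonicGasket.trunc w m) '' X = {x}) ∧
      -- for each such address, `Z` converges to the projection onto the tangent line
      (∀ x ∈ Γ, ∀ w : ℕ → Fin N, (∀ n, w n = i₁ ∨ w n = i₂) →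
        ⋂ m, HarmonicGasket.Sword (HarmonicGasket.trunc w m) '' X = {x} →
        ∀ g : ℝ → HarmonicGasket.Y N, HarmonicGasket.IsRegularParam 1 g Γ →
        ∀ t ∈ Icc (0 : ℝ) 1, g t = x →
          Tendsto (fun m => HarmonicGasket.Z (HarmonicGasket.trunc w m)) atTop
            (𝓝 (Submodule.span ℝ {derivWithin g (Icc 0 1) t}).starProjection)) := by
  have hn : (2 : ℝ) ≤ N := by exact_mod_cast hN
  have h12 : i₁ ≠ i₂ := by
    rw [hi₁, hi₂]
    simp
  have hr : 0 < exponent N := exponent_pos hn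
  obtain ⟨P, hP⟩ := exists_isSlopeParam hn
  obtain ⟨τ, h1, h2, h3, h4⟩ := hP.exists_slope hn
  have hτ : IsGraphSlope P (exponent N) τ := ⟨h1, h2, h3, h4⟩
  refine ⟨?_, ⟨_, isAttractor_image hN h12 hP, fun Γ hΓ => curve_eq_image hN h12 hP hΓ⟩, ?_⟩
  · obtain ⟨X, hX⟩ := exists_gasket hN
    refine ⟨X, hX, fun X' hX' => ?_⟩
    exact (hX'.subset ratio_S_lt_one (lipschitzWith_S hN) hX).antisymm
      (hX.subset ratio_S_lt_one (lipschitzWith_S hN) hX')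
  intro X Γ hX hΓ
  have hΓeq := curve_eq_image hN h12 hP hΓ
  have hreg := hτ.isRegularArcParam hN h12 hP hr hΓ
  refine ⟨?_, ⟨_, hreg⟩, fun hN3 => ⟨?_, ?_, _, hreg, ?_⟩, ?_, ?_⟩
  · rw [hΓeq]
    rintro _ ⟨u, -, rfl⟩
    exact Submodule.sub_mem _ (Submodule.smul_mem _ _ (Submodule.subset_span (by simp)))
      (Submodule.smul_mem _ _ (Submodule.subset_span (by simp)))
  · rintro ⟨g, hg⟩
    exact hτ.not_isRegularParam_two hN3 h12 hP hΓ hg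
  · rwa [holderExp_eq hN]
  · rw [holderExp_eq hN]
    exact hτ.holderOnWith_derivWithin hN hr
  · intro x hx
    rw [hΓeq] at hx
    obtain ⟨σ, hσ, rfl⟩ := hx
    obtain ⟨w, hw⟩ := exists_address hn hσ
    refine ⟨fun k => letter i₁ i₂ (w k), fun k => ?_, ?_⟩
    · cases h : w k <;> simp [letter, h]
    · exact (subsingleton_iInter_Sword hN hX.isCompact _).eq_singleton_of_mem
        (mem_image_Sword hN h12 hP hX hΓ hw)
  · intro x _ w hw hwx g hg t ht htx
    obtain ⟨w', rfl⟩ : ∃ w' : ℕ → Bool, (fun k => letter i₁ i₂ (w' k)) = w := by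
      refine ⟨fun k => decide (w k = i₂), funext fun k => ?_⟩
      rcases hw k with h | h <;> simp [letter, h, h12]
    obtain ⟨σ, hσ, hcell⟩ := exists_limit_slope hn w'
    have hx := mem_image_Sword hN h12 hP hX hΓ hcell
    rw [hwx, mem_singleton_iff] at hx
    have hd : DifferentiableOn ℝ g (Icc 0 1) := hg.contDiffOn.differentiableOn (by simp)
    have hder := hτ.derivWithin_param hN h12 hP hΓ hg.image_eq hd ht
    have hmem := (hτ.param_eq hN h12 hP hΓ hg.image_eq ht).1
    have hσt : τ (inner ℝ (p i₂ - p i₁) (g t) + 1 / 2) = σ := by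
      refine hτ.apply_eq hN hP hmem hσ ?_
      rw [htx, ← hx, inner_chord_emb hN h12, abscissa]
      ring
    rw [hσt] at hder
    have hne : 2 * inner ℝ (p i₂ - p i₁) (derivWithin g (Icc 0 1) t) ≠ 0 := by
      intro h0
      rw [h0, zero_smul] at hder
      exact hg.derivWithin_ne_zero t ht hder
    have hspan : Submodule.span ℝ {derivWithin g (Icc 0 1) t} =
        Submodule.span ℝ {emb i₁ i₂ (1 - σ, σ)} := by
      rw [hder, Submodule.span_singleton_smul_eq (IsUnit.mk0 _ hne)]
    simp only [hspan]
    have := tendsto_Z hN h12 (length_prefixWord w') hcell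
    simpa only [toWord_prefixWord] using this
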